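/- **Setting.** Let $n_{\rm B}\ge 1$ be an integer, and let $\lambda,R_{\rm g},R_{\rm B},\alpha,R,\bar\sigma,\gamma,P>0$, $r_0\in\mathbb R$, $p\in[0,1]$, $\beta_{\rm SF}\in[0,1)$ and $0<\Omega\le\pi/4$. For parameters $(\theta,r)$ let $L(\theta,r)=\{(x,y):x\cos\theta+y\sin\theta=r\}$, a line with direction $\mathbf a_\theta=(-\sin\theta,\cos\theta)$. The ego radar is at $E=(0,r_0)$ on the ego street $L_0=L(0,0)$ (the $y$-axis) and looks in direction $\mathbf a_0=(0,1)$. The other $n_{\rm B}-1$ of the $n_{\rm B}$ streets are $L_i=L(\theta_i,r_i)$ with $(\theta_i,r_i)$ uniform on $[0,\pi)\times[-R_{\rm g},R_{\rm g}]$. On each street, the ego street included, the vehicles form a one-dimensional Poisson process of intensity $\lambda$; the union over all $n_{\rm B}$ streets is the binomial line Cox process $\Phi_{{\rm B}_0}$. Every vehicle transmits with probability $p$, the fading power $h_{\mathbf w}$ of each vehicle is exponential with mean $1$, the radar cross-section $\sigma_{\mathbf c}$ of the target is exponential with mean $\bar\sigma$, and the streets, the Poisson processes, the transmission indicators, the fading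 powers and $\sigma_{\mathbf c}$ are all independent. The sector of a radar at $x$ with boresight $\mathbf a$ is $\mathcal R(x,\mathbf a)=\{q:\ (q-x)\cdot\mathbf a/\|q-x\|>\cos\Omega,\ \|q-x\|\le R_{\rm B}\}$. A vehicle at $q$ on a street of angle $\theta$ interferes if $q\in\mathcal R(E,\mathbf a_0)$ and $E\in\mathcal R(q,\mathbf a_\theta)\cup\mathcal R(q,-\mathbf a_\theta)$. The signal fraction is $${\rm SF}_{\rm B}=\frac{\gamma\sigma_{\mathbf c}PR^{-2\alpha}}{\gamma\sigma_{\mathbf c}PR^{-2\alpha}+\sum 4\pi\gamma P h_{\mathbf w}\|\mathbf w\|^{-\alpha}},$$ where the sum runs over the interfering vehicles that transmit and $\|\mathbf w\|$ is the distance of the vehicle from $E$. Let $p_{{\rm SF},{\rm B}}(\beta_{\rm SF})=\mathbb P({\rm SF}_{\rm B}>\beta_{\rm SF}\mid\Phi_{{\rm B}_0})$, the conditional probability given the streets and the locations of all vehicles, and $\beta_{\rm SF}'=\dfrac{4\pi\beta_{\rm SF}}{\bar\sigma R^{-2\alpha}(1-\beta_{\rm SF})}$. For $\sin\theta\ne0$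 let $v$ be the signed distance along $L(\theta,r)$ from its intersection $(0,r/\sin\theta)$ with the ego street, oriented so that $y$ does not decrease with $v$. The positions $v$ at which a vehicle would interfere form a bounded interval with endpoints $a_{\rm B}(\theta,r)\le b_{\rm B}(\theta,r)$ (both $0$ if there are none). The distance from $E$ to the vehicle at $v$ is $\|\mathbf w_{\rm B}\|=\sqrt{(d+v|\cos\theta|)^2+(v\sin\theta)^2}$ with $d=\frac{r}{\sin\theta}-r_0$. **Lemma (BLCP moments of the SF meta distribution).** Let $b\in\mathbb C$, and if $p=1$ assume in addition that $\alpha\,{\rm Re}\,b>-1$. Then $p_{{\rm SF},{\rm B}}(\beta_{\rm SF})^b$ is integrable, and the $b$-th moment $M_{b,{\rm B}}(\beta_{\rm SF})=\mathbb E\big[p_{{\rm SF},{\rm B}}(\beta_{\rm SF})^b\big]$ equals $$\exp\left(-\lambda\int_0^{R_{\rm B}}\Big[1-\Big(\tfrac{p}{1+\beta_{\rm SF}'v^{-\alpha}}+1-p\Big)^b\Big]dv\right)\left[\frac1{2\pi R_{\rm g}}\int_0^{R_{\rm g}}\!\!\int_0^{2\pi}\exp\left(-\lambda\int_{a_{\rm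 B}(\theta,r)}^{b_{\rm B}(\theta,r)}\Big[1-\Big(\tfrac{p}{1+\beta_{\rm SF}'\|\mathbf w_{\rm B}\|^{-\alpha}}+1-p\Big)^b\Big]dv\right)d\theta\,dr\right]^{n_{\rm B}-1}.$$ -/

import Mathlib

open MeasureTheory ProbabilityTheory
open scoped ENNReal NNReal Real

noncomputable section

/-! ### Poisson processes on the line -/

/-- The counting measure of the points `X 0, X 1, ...`: it gives a set the number of points in it. -/
def pointCount {S : Type*} (X : ℕ → S → ℝ) (ω : S) : Measure ℝ :=
  Measure.sum fun k => Measure.dirac (X k ω)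

/-- The points `X 0, X 1, ...` (in any measurable enumeration) form a homogeneous Poisson point
process of intensity `lam` on the real line: the number of points in a Borel set of finite length
is Poisson with mean `lam` times the length, and the numbers of points in finitely many disjoint
such sets are independent. -/
structure IsPoissonProcess {S : Type*} [MeasurableSpace S] (P : Measure S) (lam : ℝ)
    (X : ℕ → S → ℝ) : Prop where
  measurable : ∀ k, Measurable (X k)
  count_law : ∀ A : Set ℝ, MeasurableSet A → volume A ≠ ∞ →
    HasLaw (fun ω => pointCount X ω A)
      ((poissonMeasure (lam * volume.real A).toNNReal).map (fun n : ℕ => (n : ℝ≥0∞))) P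
  count_indep : ∀ (n : ℕ) (A : Fin n → Set ℝ), (∀ i, MeasurableSet (A i)) →
    (∀ i, volume (A i) ≠ ∞) → Pairwise (fun i j => Disjoint (A i) (A j)) →
    iIndepFun (fun i ω => pointCount X ω (A i)) P

/-! ### Parameters -/

/-- The numerical parameters of the network. -/
structure RadarParams where
  /-- number of streets, the ego street included -/
  nB : ℕ
  /-- intensity of vehicles on each street -/
  lam : ℝ
  /-- radius of the disk in which the streets are generated -/
  Rg : ℝ
  /-- the ego radar is at `(0, r0)` -/
  r0 : ℝ
  /-- beamwidth `Ω` -/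
  beam : ℝ
  /-- maximum unambiguous range of a radar -/
  RB : ℝ
  /-- path-loss exponent -/
  α : ℝ
  /-- transmission probability -/
  p : ℝ
  /-- distance between the ego radar and its target -/
  R : ℝ
  /-- mean radar cross-section of the target -/
  σbar : ℝ
  /-- gain constant -/
  γ : ℝ
  /-- transmit power -/
  power : ℝ
  /-- threshold of the signal fraction -/
  βSF : ℝ

/-- The ranges of the parameters. -/
structure RadarParams.Valid (c : RadarParams) : Prop where
  nB_pos : 1 ≤ c.nB
  lam_pos : 0 < c.lam
  Rg_pos : 0 < c.Rg
  beam_pos : 0 < c.beam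
  beam_le : c.beam ≤ π / 4
  RB_pos : 0 < c.RB
  α_pos : 0 < c.α
  p_nonneg : 0 ≤ c.p
  p_le_one : c.p ≤ 1
  R_pos : 0 < c.R
  σbar_pos : 0 < c.σbar
  γ_pos : 0 < c.γ
  power_pos : 0 < c.power
  βSF_nonneg : 0 ≤ c.βSF
  βSF_lt_one : c.βSF < 1

/-! ### Geometry: radar sectors and interference -/

/-- The Euclidean plane. -/
abbrev Plane : Type := EuclideanSpace ℝ (Fin 2)

/-- The direction of the street `x cos θ + y sin θ = r`. -/
def boresight (θ : ℝ) : Plane := !₂[-Real.sin θ, Real.cos θ]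

/-- The point at signed distance `t` from the foot of the perpendicular dropped from the origin on
the street `x cos θ + y sin θ = r`. -/
def streetPoint (θ r t : ℝ) : Plane :=
  !₂[r * Real.cos θ - t * Real.sin θ, r * Real.sin θ + t * Real.cos θ]

/-- The sector of a radar at `x` with boresight direction the unit vector `a`. -/
def radarSector (beam range : ℝ) (x a : Plane) : Set Plane :=
  {q | Real.cos beam < inner ℝ (q - x) a / ‖q - x‖ ∧ ‖q - x‖ ≤ range}

namespace RadarParams

variable (c : RadarParams)

/-- The location of the ego radar, on the street with parameters `(0, 0)` (the `y`-axis). -/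
def ego : Plane := !₂[0, c.r0]

/-- A vehicle at `q`, on a street with generating angle `θ`, interferes with the ego radar: `q` is
in the sector of the (forward) ego radar, and the ego radar is in the sector of the front or of the
rear radar of the vehicle. -/
def Interferes (θ : ℝ) (q : Plane) : Prop :=
  q ∈ radarSector c.beam c.RB c.ego (boresight 0) ∧
    (c.ego ∈ radarSector c.beam c.RB q (boresight θ) ∨
      c.ego ∈ radarSector c.beam c.RB q (-boresight θ))

/-! Interfering distances: points of the street `(θ, r)` are located by their signed distance `v`
from the intersection `(0, r / sin θ)` with the ego street (`sin θ ≠ 0`). -/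

/-- The point of the street `(θ, r)` at signed distance `v` from its intersection with the ego
street; `v` increases with the `y`-coordinate. -/
def crossPoint (θ r v : ℝ) : Plane :=
  !₂[0, r / Real.sin θ] + (v * (if 0 ≤ Real.cos θ then 1 else -1)) • boresight θ

/-- The interfering distances on the street `(θ, r)`. -/
def interferingSection (θ r : ℝ) : Set ℝ := {v | c.Interferes θ (crossPoint θ r v)}

/-- Lower bound `a_B` of the interfering distance (`0` if there is no interfering position). -/
def aB (θ r : ℝ) : ℝ := sInf (c.interferingSection θ r)

/-- Upper bound `b_B` of the interfering distance (`0` if there is no interfering position). -/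
def bB (θ r : ℝ) : ℝ := sSup (c.interferingSection θ r)

/-- The distance `‖w_B‖` from the ego radar to the vehicle at distance `v` from the intersection;
`d = r / sin θ - r0` is the signed distance from the ego radar to the intersection. -/
def wB (θ r v : ℝ) : ℝ :=
  √((r / Real.sin θ - c.r0 + v * |Real.cos θ|) ^ 2 + (v * Real.sin θ) ^ 2)

/-- The normalised threshold `β'_SF`. -/
def β' : ℝ := 4 * π * c.βSF / (c.σbar * c.R ^ (-2 * c.α) * (1 - c.βSF))

/-- The domain of the street parameters `(θ, r)`. -/
def streetDomain : Set (ℝ × ℝ) := Set.Ico 0 π ×ˢ Set.Icc (-c.Rg) c.Rg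

/-- The streets: `none` is the ego street, the others are the remaining `nB - 1` streets. -/
abbrev Street : Type := Option (Fin (c.nB - 1))

end RadarParams

/-! ### The binomial line Cox process with its marks -/

/-- The random elements of the network over a sample space `S`. -/
structure RadarNetwork (c : RadarParams) (S : Type*) where
  /-- the parameters `(θ, r)` of the streets other than the ego street -/
  line : Fin (c.nB - 1) → S → ℝ × ℝ
  /-- the positions of the vehicles along each street -/
  pos : c.Street → ℕ → S → ℝ
  /-- the fading power of the interference from each vehicle -/
  fading : c.Street → ℕ → S → ℝ
  /-- whether each vehicle transmits -/
  transmits : c.Street → ℕ → S → Bool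
  /-- the radar cross-section of the target -/
  rcs : S → ℝ

/-- Labels of the independent sources of randomness. -/
inductive RadarSource (c : RadarParams) : Type
  | line (i : Fin (c.nB - 1))
  | pos (j : c.Street)
  | fading (j : c.Street) (k : ℕ)
  | transmits (j : c.Street) (k : ℕ)
  | rcs

namespace RadarNetwork

variable {c : RadarParams} {S : Type*} (N : RadarNetwork c S)

/-- The σ-algebra generated by one source of randomness. -/
def sigma : RadarSource c → MeasurableSpace S
  | .line i => MeasurableSpace.comap (N.line i) inferInstance
  | .pos j => MeasurableSpace.comap (fun ω k => N.pos j k ω) inferInstance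
  | .fading j k => MeasurableSpace.comap (N.fading j k) inferInstance
  | .transmits j k => MeasurableSpace.comap (N.transmits j k) inferInstance
  | .rcs => MeasurableSpace.comap N.rcs inferInstance

/-- The model: the `nB - 1` streets other than the ego street are uniform on
`[0, π) × [-R_g, R_g]`, the vehicles on each street form a Poisson process of intensity `lam`, the
fading is exponential of mean `1`, every vehicle transmits with probability `p`, the radar
cross-section is exponential of mean `σbar`, and all of these are mutually independent. -/
structure IsBLCP [MeasurableSpace S] (P : Measure S) : Prop where
  measurable_line : ∀ i, Measurable (N.line i)
  line_law : ∀ i, HasLaw (N.line i) (cond volume c.streetDomain) P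
  pos_poisson : ∀ j, IsPoissonProcess P c.lam (N.pos j)
  measurable_fading : ∀ j k, Measurable (N.fading j k)
  fading_law : ∀ j k, HasLaw (N.fading j k) (expMeasure 1) P
  measurable_transmits : ∀ j k, Measurable (N.transmits j k)
  transmits_law : ∀ j k, P.real {ω | N.transmits j k ω = true} = c.p
  measurable_rcs : Measurable N.rcs
  rcs_law : HasLaw N.rcs (expMeasure c.σbar⁻¹) P
  indep : iIndep N.sigma P

/-- The parameters `(θ, r)` of a street; the ego street is `(0, 0)`. -/
def street : c.Street → S → ℝ × ℝ
  | none => fun _ => (0, 0)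
  | some i => N.line i

/-- The location in the plane of the `k`-th vehicle on street `j`. -/
def vehicle (j : c.Street) (k : ℕ) (ω : S) : Plane :=
  streetPoint (N.street j ω).1 (N.street j ω).2 (N.pos j k ω)

/-- The power of the signal reflected by the target. -/
def signal (ω : S) : ℝ := c.γ * N.rcs ω * c.power * c.R ^ (-2 * c.α)

open Classical in
/-- The total power received from the interfering vehicles that transmit. -/
def interference (ω : S) : ℝ :=
  ∑ j : c.Street, ∑' k : ℕ,
    if c.Interferes (N.street j ω).1 (N.vehicle j k ω) ∧ N.transmits j k ω = true then
      4 * π * c.γ * c.power * N.fading j k ω * ‖N.vehicle j k ω - c.ego‖ ^ (-c.α)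
    else 0

/-- The signal fraction. -/
def SF (ω : S) : ℝ := N.signal ω / (N.signal ω + N.interference ω)

/-- The information in the streets and in the locations of all vehicles. -/
def geometry : MeasurableSpace S :=
  (⨆ i, N.sigma (.line i)) ⊔ (⨆ j, N.sigma (.pos j))

/-- The conditional success probability `p_SF(β_SF)`: the conditional probability of
`SF > β_SF`, given the streets and the locations of all vehicles. -/
def pSF [MeasurableSpace S] (P : Measure S) : S → ℝ :=
  P⟦{ω | c.βSF < N.SF ω} | N.geometry⟧

end RadarNetwork

end

/-!
Given the streets and the vehicle positions, the remaining randomness is the radar cross-section,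
the fading and the transmission indicators. The event `SF > β_SF` says that the radar cross-section
exceeds `σbar` times the total normalised interference
(`RadarNetwork.IsBLCP.ae_lt_SF_iff`). The cross-section is exponential, so its conditional
probability given everything else is the exponential of minus that total; integrating out
the fading and the transmission indicators one vehicle at a time turns this into the product over
the vehicles of `p / (1 + β' w ^ (-α)) + 1 - p`, where vehicles that do not interfere contribute `1`
(`RadarNetwork.IsBLCP.pSF_ae_eq`). Almost surely only finitely many vehicles interfere, so the
infinite products are finite ones; they are handled as limits of partial products.

The `b`-th power of the product is the product of the `b`-th powers, and the contributions of
different streets are independent. For a fixed street, the expectation is the probability generating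
functional of a Poisson process, `E ∏ (1 + u (X k)) = exp (lam * ∫ u)`, for a complex-valued `u`
(`IsPoissonProcess.integral_finprod_one_add`). It is proved for simple functions from the Poisson
law and the independence of the counts, and in general by approximation. The integrability of
`u`, uniformly over the streets, is where `α Re b > -1` is needed if `p = 1`
(`RadarParams.exists_bound_powerDeviation`): on a line, the distance to the ego radar is at least
the distance `s` to the foot of the perpendicular, and `s ^ (α Re b)` is integrable near `0`.

It remains to rewrite the exponent and the average over the streets. Since the beamwidth is at most
`π / 4`, a street meets the interfering region in a convex set
(`RadarParams.convex_interferingRegion_section`), which is an interval between `aB` and `bB` up to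
its endpoints; and the uniform average over `θ ∈ [0, π)`, `r ∈ [-Rg, Rg]` becomes the one over
`θ ∈ (0, 2π)`, `r ∈ (0, Rg)` because `(θ + π, r)` and `(θ, -r)` are the same line
(`RadarParams.integral_streetMoment`).
-/

open MeasureTheory ProbabilityTheory Filter Topology
open scoped ENNReal NNReal Real

noncomputable section

/-! ### Independence and transforms of the exponential, Bernoulli and Poisson laws -/

/-- Fubini's theorem for independent random variables: `Z` is integrated out first. -/
theorem integral_comp_prod_of_indepFun {S α β E : Type*} [MeasurableSpace S] [MeasurableSpace α]
    [MeasurableSpace β] [NormedAddCommGroup E] [NormedSpace ℝ E] {P : Measure S}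
    [IsProbabilityMeasure P] {X : S → α} {Z : S → β} (hX : Measurable X) (hZ : Measurable Z)
    (h : IndepFun X Z P) {Φ : α × β → E} (hΦ : StronglyMeasurable Φ)
    (hint : Integrable (fun ω => Φ (X ω, Z ω)) P) :
    ∫ ω, Φ (X ω, Z ω) ∂P = ∫ ω, (∫ z, Φ (X ω, z) ∂(P.map Z)) ∂P := by
  have hmap := (indepFun_iff_map_prod_eq_prod_map_map hX.aemeasurable hZ.aemeasurable).1 h
  have hp1 := Measure.isProbabilityMeasure_map (μ := P) hX.aemeasurable
  have hp2 := Measure.isProbabilityMeasure_map (μ := P) hZ.aemeasurable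
  have hint' : Integrable Φ ((P.map X).prod (P.map Z)) := by
    rw [← hmap]
    exact (integrable_map_measure hΦ.aestronglyMeasurable (hX.prodMk hZ).aemeasurable).2 hint
  have h1 : ∫ ω, Φ (X ω, Z ω) ∂P = ∫ x, Φ x ∂((P.map X).prod (P.map Z)) := by
    rw [← hmap, integral_map (hX.prodMk hZ).aemeasurable hΦ.aestronglyMeasurable]
  rw [h1, integral_prod _ hint', integral_map hX.aemeasurable]
  exact (StronglyMeasurable.integral_prod_right' hΦ).aestronglyMeasurable

theorem integral_expMeasure {r : ℝ} (hr : 0 < r) (g : ℝ → ℝ) :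
    ∫ x, g x ∂(expMeasure r) = ∫ x in Set.Ioi 0, r * Real.exp (-(r * x)) * g x := by
  have : expMeasure r = volume.withDensity
      (fun x => ((exponentialPDFReal r x).toNNReal : ℝ≥0∞)) := rfl
  rw [this, integral_withDensity_eq_integral_smul
    ((measurable_exponentialPDFReal r).real_toNNReal), ← integral_Ici_eq_integral_Ioi,
    ← integral_indicator measurableSet_Ici]
  refine integral_congr_ae (Eventually.of_forall fun x => ?_)
  by_cases hx : 0 ≤ x
  · rw [Set.indicator_of_mem (Set.mem_Ici.2 hx)]
    have h0 := exponentialPDFReal_nonneg hr x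
    simp only [NNReal.smul_def, Real.coe_toNNReal _ h0, smul_eq_mul]
    simp [exponentialPDFReal, gammaPDFReal, hx]
  · rw [Set.indicator_of_notMem (by simpa using hx)]
    simp [exponentialPDFReal, gammaPDFReal, hx]

theorem integral_exp_neg_mul_expMeasure {r : ℝ} (hr : 0 < r) {t : ℝ} (ht : 0 ≤ t) :
    ∫ x, Real.exp (-(t * x)) ∂(expMeasure r) = r / (r + t) := by
  rw [integral_expMeasure hr]
  have : ∀ x : ℝ, r * Real.exp (-(r * x)) * Real.exp (-(t * x)) =
      r * Real.exp (-(r + t) * x) := fun x => by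
    rw [mul_assoc, ← Real.exp_add]; ring_nf
  simp_rw [this]
  rw [integral_const_mul, integral_exp_mul_Ioi (by linarith)]
  have : r + t ≠ 0 := by positivity
  simp only [mul_zero, Real.exp_zero]
  field_simp

theorem expMeasure_real_Ioi {r : ℝ} (hr : 0 < r) {t : ℝ} (ht : 0 ≤ t) :
    (expMeasure r).real (Set.Ioi t) = Real.exp (-(r * t)) := by
  have := isProbabilityMeasure_expMeasure hr
  have h := cdf_expMeasure_eq hr t
  rw [if_pos ht, cdf_eq_real] at h
  have h2 := probReal_compl_eq_one_sub (μ := expMeasure r) (measurableSet_Iic (a := t))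
  rw [Set.compl_Iic, h] at h2
  linarith

theorem expMeasure_Iic_zero {r : ℝ} (hr : 0 < r) : expMeasure r (Set.Iic 0) = 0 := by
  have := isProbabilityMeasure_expMeasure hr
  have h := cdf_expMeasure_eq hr 0
  rw [cdf_eq_real] at h
  rw [← measureReal_eq_zero_iff, h]
  simp

theorem integral_map_bool {S : Type*} [MeasurableSpace S] {P : Measure S}
    [IsProbabilityMeasure P] {τ : S → Bool} (hτ : Measurable τ) {p : ℝ}
    (hp : P.real {ω | τ ω = true} = p) (g : Bool → ℝ) :
    ∫ z, g z ∂(P.map τ) = p * g true + (1 - p) * g false := by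
  have := Measure.isProbabilityMeasure_map (μ := P) hτ.aemeasurable
  have h1 : (P.map τ).real {true} = p := by
    rw [map_measureReal_apply hτ (by simp)]; exact hp
  have h2 : (P.map τ).real {false} = 1 - p := by
    rw [← h1, ← probReal_compl_eq_one_sub (by simp)]
    congr 1; ext b; cases b <;> simp
  rw [integral_fintype Integrable.of_finite]
  simp [h1, h2]

theorem integral_pow_poissonMeasure (r : ℝ≥0) (z : ℂ) :
    Integrable (fun n : ℕ => z ^ n) (poissonMeasure r) ∧
      ∫ n, z ^ n ∂(poissonMeasure r) = Complex.exp (r * (z - 1)) := by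
  have hs : HasSum (fun n : ℕ => (r * z) ^ n / (n.factorial : ℂ)) (Complex.exp (r * z)) := by
    rw [Complex.exp_eq_exp_ℂ]
    exact NormedSpace.expSeries_div_hasSum_exp _
  constructor
  · rw [integrable_poissonMeasure_iff]
    have := (hs.summable.norm).mul_left (Real.exp (-r))
    refine this.congr fun n => ?_
    simp [mul_pow]
    ring
  · rw [integral_poissonMeasure]
    have h := (hs.mul_left (Complex.exp (-r))).tsum_eq
    rw [← Complex.exp_add] at h
    rw [show (r : ℂ) * (z - 1) = -r + r * z by ring, ← h]
    congr 1 with n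
    simp [mul_pow]
    ring

theorem iIndepFun_integrable_prod {S ι : Type*} [MeasurableSpace S] [Fintype ι] {P : Measure S}
    {X : ι → S → ℂ} (h : iIndepFun X P) (hm : ∀ i, Measurable (X i))
    (hX : ∀ i, Integrable (X i) P) : Integrable (fun ω => ∏ i, X i ω) P := by
  refine ⟨(Finset.measurable_fun_prod _ fun i _ => hm i).aestronglyMeasurable, ?_⟩
  have h' : iIndepFun (fun i ω => ‖X i ω‖ₑ) P := h.comp (fun _ z => ‖z‖ₑ) fun _ => measurable_enorm
  have := lintegral_prod_eq_prod_lintegral_of_indepFun Finset.univ _ h' fun i => (hm i).enorm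
  rw [HasFiniteIntegral]
  simp_rw [show ∀ ω, ‖∏ i, X i ω‖ₑ = ∏ i, ‖X i ω‖ₑ from fun ω => by
    simp [enorm_eq_nnnorm, nnnorm_prod]]
  rw [this]
  exact ENNReal.prod_lt_top fun i _ => (hX i).2

/-- Independence is inherited by disjoint groups of σ-algebras. -/
theorem iIndep_biSup_of_pairwise_disjoint {S ι κ : Type*} {mS : MeasurableSpace S} {P : Measure S}
    {m : ι → MeasurableSpace S} (hle : ∀ i, m i ≤ mS) (h : iIndep m P) {T : κ → Set ι}
    (hT : Pairwise (Function.onFun Disjoint T)) : iIndep (fun a => ⨆ i ∈ T a, m i) P := by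
  have := h.isProbabilityMeasure
  classical
  rw [iIndep_iff]
  intro s
  induction s using Finset.cons_induction with
  | empty => simp
  | cons a s ha ih =>
    intro f hf
    have hd : Disjoint (T a) (⋃ b ∈ s, T b) := by
      rw [Set.disjoint_iUnion₂_right]
      exact fun b hb => hT fun e => ha (e ▸ hb)
    have hI := indep_iSup_of_disjoint hle h hd
    have hs : MeasurableSet[⨆ i ∈ ⋃ b ∈ s, T b, m i] (⋂ i ∈ s, f i) := by
      refine Finset.measurableSet_biInter (m := ⨆ i ∈ ⋃ b ∈ s, T b, m i) s fun b hb => ?_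
      have hbs : T b ⊆ ⋃ b ∈ s, T b := Set.subset_biUnion_of_mem (u := T) hb
      have hle' : (⨆ i ∈ T b, m i) ≤ ⨆ i ∈ ⋃ b ∈ s, T b, m i := biSup_mono fun i hi => hbs hi
      exact hle' _ (hf b (Finset.mem_cons_of_mem hb))
    rw [Finset.prod_cons, ← ih fun i hi => hf i (Finset.mem_cons_of_mem hi)]
    rw [Finset.cons_eq_insert, Finset.set_biInter_insert]
    exact (Indep_iff _ _ _).1 hI _ _ (hf a (Finset.mem_cons_self a s)) hs

/-! ### The probability generating functional of a Poisson process -/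

theorem pointCount_eq_card {S : Type*} {X : ℕ → S → ℝ} {ω : S} {A : Set ℝ} (hA : MeasurableSet A)
    (hfin : {k | X k ω ∈ A}.Finite) : pointCount X ω A = (hfin.toFinset.card : ℝ≥0∞) := by
  rw [pointCount, Measure.sum_apply _ hA]
  rw [tsum_eq_sum (s := hfin.toFinset)]
  · rw [Finset.card_eq_sum_ones]
    push_cast
    refine Finset.sum_congr rfl fun k hk => ?_
    have : X k ω ∈ A := by simpa using hk
    simp [hA, this]
  · intro k hk
    have : X k ω ∉ A := by simpa using hk
    simp [hA, this]

theorem IsPoissonProcess.ae_finite {S : Type*} [MeasurableSpace S] {P : Measure S} {lam : ℝ}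
    {X : ℕ → S → ℝ} (h : IsPoissonProcess P lam X) {A : Set ℝ} (hA : MeasurableSet A)
    (hvol : volume A ≠ ∞) : ∀ᵐ ω ∂P, {k | X k ω ∈ A}.Finite := by
  have hl := h.count_law A hA hvol
  have h1 : ∀ᵐ x ∂(P.map fun ω => pointCount X ω A), x ≠ ∞ := by
    rw [hl.map_eq, ae_map_iff (by fun_prop) (by measurability)]
    simp
  filter_upwards [ae_of_ae_map hl.aemeasurable h1] with ω hω
  rw [pointCount, Measure.sum_apply _ hA] at hω
  refine (ENNReal.finite_const_le_of_tsum_ne_top hω one_ne_zero).subset fun k hk => ?_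
  have : X k ω ∈ A := hk
  simp [hA, this]

/-- The joint probability generating function of the counts in disjoint sets. The counts take values
in `ℝ≥0∞`; the floor of `toReal` recovers the natural number, as they are almost surely finite. -/
theorem IsPoissonProcess.integral_prod_pow_count {S : Type*} [MeasurableSpace S] {P : Measure S}
    {lam : ℝ} (hlam : 0 ≤ lam)
    {X : ℕ → S → ℝ} (h : IsPoissonProcess P lam X) {ι : Type*} [Fintype ι] (A : ι → Set ℝ)
    (hA : ∀ i, MeasurableSet (A i)) (hvol : ∀ i, volume (A i) ≠ ∞)
    (hd : Pairwise (Function.onFun Disjoint A)) (z : ι → ℂ) :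
    Integrable (fun ω => ∏ i, z i ^ ⌊(pointCount X ω (A i)).toReal⌋₊) P ∧
      ∫ ω, ∏ i, z i ^ ⌊(pointCount X ω (A i)).toReal⌋₊ ∂P =
        Complex.exp (lam * ∑ i, volume.real (A i) * (z i - 1)) := by
  have hmeas : ∀ i, Measurable (fun ω => pointCount X ω (A i)) := fun i => by
    have : ∀ ω, pointCount X ω (A i) = ∑' k, (A i).indicator 1 (X k ω) := fun ω => by
      rw [pointCount, Measure.sum_apply _ (hA i)]
      simp [hA i]
    simp_rw [this]
    exact Measurable.tsum fun k =>
      (measurable_const.indicator (hA i)).comp (h.measurable k)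
  have hφ : ∀ i, Measurable (fun x : ℝ≥0∞ => z i ^ ⌊x.toReal⌋₊) := fun i =>
    (measurable_of_countable fun n : ℕ => z i ^ n).comp
      (Nat.measurable_floor.comp ENNReal.measurable_toReal)
  have hind : iIndepFun (fun i ω => pointCount X ω (A i)) P := by
    have e := Fintype.equivFin ι
    have := h.count_indep _ (fun k => A (e.symm k)) (fun _ => hA _) (fun _ => hvol _)
      fun i j hij => hd fun h => hij (e.symm.injective h)
    have := this.precomp e.injective
    simpa [Function.comp_def] using this
  have hind' := hind.comp (fun i x => z i ^ ⌊x.toReal⌋₊) hφ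
  have hone : ∀ i, Integrable (fun ω => z i ^ ⌊(pointCount X ω (A i)).toReal⌋₊) P ∧
      ∫ ω, z i ^ ⌊(pointCount X ω (A i)).toReal⌋₊ ∂P =
        Complex.exp (lam * (volume.real (A i) * (z i - 1))) := fun i => by
    have hl := h.count_law (A i) (hA i) (hvol i)
    have hp := integral_pow_poissonMeasure (lam * volume.real (A i)).toNNReal (z i)
    have hc : Measurable (fun n : ℕ => (n : ℝ≥0∞)) := measurable_of_countable _
    constructor
    · have : Integrable (fun x : ℝ≥0∞ => z i ^ ⌊x.toReal⌋₊)
          (P.map fun ω => pointCount X ω (A i)) := by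
        rw [hl.map_eq, integrable_map_measure (hφ i).aestronglyMeasurable hc.aemeasurable]
        simpa [Function.comp_def] using hp.1
      exact this.comp_aemeasurable hl.aemeasurable
    · rw [← integral_map (φ := fun ω => pointCount X ω (A i))
        (f := fun x : ℝ≥0∞ => z i ^ ⌊x.toReal⌋₊) hl.aemeasurable (hφ i).aestronglyMeasurable,
        hl.map_eq, integral_map hc.aemeasurable (hφ i).aestronglyMeasurable]
      simp only [ENNReal.toReal_natCast, Nat.floor_natCast]
      rw [hp.2]
      have : ((lam * volume.real (A i)).toNNReal : ℝ) = lam * volume.real (A i) :=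
        Real.coe_toNNReal _ (by positivity)
      have : (((lam * volume.real (A i)).toNNReal : ℝ) : ℂ) = lam * volume.real (A i) := by
        rw [this]; push_cast; rfl
      rw [show (((lam * volume.real (A i)).toNNReal : ℝ≥0) : ℂ) = lam * volume.real (A i) from this,
        mul_assoc]
  refine ⟨iIndepFun_integrable_prod hind' (fun i => (hφ i).comp (hmeas i)) fun i => (hone i).1, ?_⟩
  have := hind'.integral_fun_prod_eq_prod_integral
    fun i => ((hφ i).comp (hmeas i)).aestronglyMeasurable
  simp only [Function.comp_def] at this
  rw [this, Finset.mul_sum, Complex.exp_sum]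
  exact Finset.prod_congr rfl fun i _ => (hone i).2

/-- The probability generating functional at a simple function: the product over the points is a
product of powers of the numbers of points in the level sets. -/
theorem IsPoissonProcess.integral_finprod_simpleFunc {S : Type*} [MeasurableSpace S]
    {P : Measure S} {lam : ℝ} (hlam : 0 ≤ lam) {X : ℕ → S → ℝ} (h : IsPoissonProcess P lam X)
    (u : SimpleFunc ℝ ℂ) (hu : volume (Function.support u) ≠ ∞) :
    Integrable (fun ω => ∏ᶠ k, (1 + u (X k ω))) P ∧
      ∫ ω, ∏ᶠ k, (1 + u (X k ω)) ∂P = Complex.exp (lam * ∫ t, u t) := by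
  classical
  set R : Finset ℂ := u.range.filter (· ≠ 0) with hR
  have hsub : ∀ y : R, u ⁻¹' {(y : ℂ)} ⊆ Function.support u := fun y t ht => by
    have : u t = y := ht
    have hy := (Finset.mem_filter.1 y.2).2
    simpa [this] using hy
  have hvol : ∀ y : R, volume (u ⁻¹' {(y : ℂ)}) ≠ ∞ := fun y =>
    ne_top_of_le_ne_top hu (measure_mono (hsub y))
  have hms : ∀ y : ℂ, MeasurableSet (u ⁻¹' {y}) := fun y => u.measurableSet_fiber y
  have key := h.integral_prod_pow_count hlam (fun y : R => u ⁻¹' {(y : ℂ)}) (fun y => hms y) hvol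
    (fun y y' hyy => Set.disjoint_left.2 fun t (ht : u t = y) (ht' : u t = y') =>
      hyy (Subtype.ext (ht.symm.trans ht'))) (fun y => 1 + y)
  have hae : ∀ᵐ ω ∂P, ∏ᶠ k, (1 + u (X k ω)) =
      ∏ y : R, (1 + (y : ℂ)) ^ ⌊(pointCount X ω (u ⁻¹' {(y : ℂ)})).toReal⌋₊ := by
    have hfin : ∀ᵐ ω ∂P, {k | X k ω ∈ Function.support u}.Finite :=
      h.ae_finite u.measurableSet_support hu
    filter_upwards [hfin] with ω hω
    have hF : Function.mulSupport (fun k => 1 + u (X k ω)) ⊆ hω.toFinset := by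
      intro k hk
      have : u (X k ω) ≠ 0 := by simpa using hk
      simpa using this
    rw [finprod_eq_prod_of_mulSupport_subset _ hF]
    have hmap : ∀ k ∈ hω.toFinset, u (X k ω) ∈ R := fun k hk => by
      have : u (X k ω) ≠ 0 := by simpa using hk
      simp [hR, this]
    rw [← Finset.prod_fiberwise_of_maps_to hmap, Finset.univ_eq_attach,
      ← Finset.prod_attach (s := R)]
    refine Finset.prod_congr rfl fun y _ => ?_
    have hfy : {k | X k ω ∈ u ⁻¹' {(y : ℂ)}}.Finite := hω.subset fun k hk => hsub y hk
    rw [pointCount_eq_card (hms y) hfy]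
    simp only [ENNReal.toReal_natCast, Nat.floor_natCast]
    rw [Finset.prod_congr rfl (g := fun _ => 1 + (y : ℂ)) fun k hk => by
      rw [(Finset.mem_filter.1 hk).2], Finset.prod_const]
    congr 2
    ext k
    simp only [Finset.mem_filter, Set.Finite.mem_toFinset]
    exact ⟨fun hk => hk.2, fun hk => ⟨hsub y hk, hk⟩⟩
  refine ⟨key.1.congr (hae.mono fun ω hω => hω.symm), ?_⟩
  rw [integral_congr_ae hae, key.2]
  have hint : Integrable u volume := by
    rw [SimpleFunc.integrable_iff]
    intro y hy
    exact lt_top_iff_ne_top.2 (ne_top_of_le_ne_top hu (measure_mono fun t ht => by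
      have : u t = y := ht
      simpa [this] using hy))
  rw [SimpleFunc.integral_eq_sum _ hint, ← Finset.sum_filter_of_ne (s := u.range)
    (f := fun y => volume.real (u ⁻¹' {y}) • y) (p := (· ≠ 0)), ← hR, ← Finset.sum_attach (s := R)]
  · simp
  · intro y _ hy h0
    exact hy (by simp [h0])

/-- The probability generating functional of a Poisson process. The simple functions approximating
`u` are bounded by `2 ‖u‖`, so that `∏ (1 + 2 ‖u‖)` dominates the approximating products; it is
integrable by Fatou's lemma and the case of simple functions. -/
theorem IsPoissonProcess.integral_finprod_one_add {S : Type*} [MeasurableSpace S]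
    {P : Measure S} {lam : ℝ} (hlam : 0 ≤ lam) {X : ℕ → S → ℝ} (h : IsPoissonProcess P lam X)
    {u : ℝ → ℂ} (hum : Measurable u) {B : Set ℝ} (hB : MeasurableSet B) (hvol : volume B ≠ ∞)
    (huB : Function.support u ⊆ B) (hint : Integrable u) :
    Integrable (fun ω => ∏ᶠ k, (1 + u (X k ω))) P ∧
      ∫ ω, ∏ᶠ k, (1 + u (X k ω)) ∂P = Complex.exp (lam * ∫ t, u t) := by
  set v : ℕ → SimpleFunc ℝ ℂ := SimpleFunc.approxOn u hum Set.univ 0 (Set.mem_univ _) with hv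
  have hvlim : ∀ t, Tendsto (fun n => v n t) atTop (𝓝 (u t)) := fun t =>
    SimpleFunc.tendsto_approxOn hum (Set.mem_univ _) (by simp)
  have hvle : ∀ n t, ‖v n t‖ ≤ 2 * ‖u t‖ := fun n t =>
    (SimpleFunc.norm_approxOn_zero_le hum (Set.mem_univ _) t n).trans_eq (by ring)
  have hvB : ∀ n, Function.support (v n) ⊆ B := fun n t ht => huB fun h0 => ht <| by
    have := hvle n t
    rw [h0, norm_zero, mul_zero] at this
    exact norm_le_zero_iff.1 this
  have hfin := h.ae_finite hB hvol
  have hprod : ∀ {g : ℝ → ℂ}, Function.support g ⊆ B → ∀ {ω} (hω : {k | X k ω ∈ B}.Finite),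
      ∏ᶠ k, (1 + g (X k ω)) = ∏ k ∈ hω.toFinset, (1 + g (X k ω)) := fun {g} hg ω hω => by
    refine finprod_eq_prod_of_mulSupport_subset _ fun k hk => ?_
    have : X k ω ∈ Function.support g := by simpa using hk
    simpa using hg this
  have hlim : ∀ {g : ℝ → ℂ} {gn : ℕ → ℝ → ℂ}, Function.support g ⊆ B →
      (∀ n, Function.support (gn n) ⊆ B) → (∀ t, Tendsto (fun n => gn n t) atTop (𝓝 (g t))) →
      ∀ᵐ ω ∂P, Tendsto (fun n => ∏ᶠ k, (1 + gn n (X k ω))) atTop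
        (𝓝 (∏ᶠ k, (1 + g (X k ω)))) := fun hg hgn ht => by
    filter_upwards [hfin] with ω hω
    simp_rw [hprod hg hω, hprod (hgn _) hω]
    exact tendsto_finsetProd _ fun k _ => (ht _).const_add 1
  have hsimple := fun n => h.integral_finprod_simpleFunc hlam (v n)
    (ne_top_of_le_ne_top hvol (measure_mono (hvB n)))
  -- the dominating product
  set w : ℕ → SimpleFunc ℝ ℂ := fun n => (v n).map fun z => ((2 * ‖z‖ : ℝ) : ℂ) with hw
  have hw_apply : ∀ n t, w n t = ((2 * ‖v n t‖ : ℝ) : ℂ) := fun n t => rfl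
  have hwB : ∀ n, Function.support (w n) ⊆ B := fun n t ht => hvB n fun h0 => ht <| by
    simp [hw_apply, h0]
  set D : S → ℂ := fun ω => ∏ᶠ k, (1 + ((2 * ‖u (X k ω)‖ : ℝ) : ℂ)) with hD
  have huB' : Function.support (fun t => ((2 * ‖u t‖ : ℝ) : ℂ)) ⊆ B := fun t ht =>
    huB fun h0 => ht <| by simp [h0]
  have hwsimple := fun n => h.integral_finprod_simpleFunc hlam (w n)
    (ne_top_of_le_ne_top hvol (measure_mono (hwB n)))
  have hDlim : ∀ᵐ ω ∂P, Tendsto (fun n => ∏ᶠ k, (1 + w n (X k ω))) atTop (𝓝 (D ω)) := by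
    refine hlim (g := fun t => ((2 * ‖u t‖ : ℝ) : ℂ)) huB' hwB fun t => ?_
    simp_rw [hw_apply]
    exact (Complex.continuous_ofReal.tendsto _).comp ((hvlim t).norm.const_mul 2)
  have hwreal : ∀ᵐ ω ∂P, ∀ n, ∏ᶠ k, (1 + w n (X k ω)) =
      ((‖∏ᶠ k, (1 + w n (X k ω))‖ : ℝ) : ℂ) := by
    filter_upwards [hfin] with ω hω n
    simp_rw [hprod (hwB n) hω, hw_apply]
    have : ∏ k ∈ hω.toFinset, (1 + ((2 * ‖v n (X k ω)‖ : ℝ) : ℂ)) =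
        ((∏ k ∈ hω.toFinset, (1 + 2 * ‖v n (X k ω)‖) : ℝ) : ℂ) := by push_cast; rfl
    rw [this, Complex.norm_real, Real.norm_of_nonneg]
    exact Finset.prod_nonneg fun k _ => by positivity
  have hwnorm : ∀ n, ∫⁻ ω, ‖∏ᶠ k, (1 + w n (X k ω))‖ₑ ∂P ≤
      ENNReal.ofReal (Real.exp (lam * (4 * ∫ t, ‖u t‖))) := fun n => by
    rw [← ofReal_integral_norm_eq_lintegral_enorm (hwsimple n).1]
    apply ENNReal.ofReal_le_ofReal
    have h1 : ((∫ ω, ‖∏ᶠ k, (1 + w n (X k ω))‖ ∂P : ℝ) : ℂ) =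
        ((Real.exp (lam * ∫ t, 2 * ‖v n t‖) : ℝ) : ℂ) := by
      rw [← integral_complex_ofReal]
      rw [← integral_congr_ae (hwreal.mono fun ω hω => hω n), (hwsimple n).2]
      simp_rw [hw_apply]
      rw [integral_complex_ofReal]
      push_cast; rfl
    rw [Complex.ofReal_inj.1 h1]
    have hle : ∫ t, 2 * ‖v n t‖ ≤ 4 * ∫ t, ‖u t‖ := by
      rw [← integral_const_mul]
      refine integral_mono_of_nonneg (Eventually.of_forall fun t => by positivity)
        (hint.norm.const_mul 4) (Eventually.of_forall fun t => ?_)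
      have := hvle n t
      simp only
      linarith
    exact Real.exp_le_exp.2 (mul_le_mul_of_nonneg_left hle hlam)
  have hDint : Integrable D P := by
    refine ⟨aestronglyMeasurable_of_tendsto_ae _ (fun n => (hwsimple n).1.1) hDlim, ?_⟩
    rw [HasFiniteIntegral, lintegral_congr_ae (g := fun ω => liminf
      (fun n => ‖∏ᶠ k, (1 + w n (X k ω))‖ₑ) atTop)
      (by filter_upwards [hDlim] with ω hω using hω.enorm.liminf_eq.symm)]
    refine (lintegral_liminf_le' fun n => (hwsimple n).1.1.enorm).trans_lt ?_
    refine lt_of_le_of_lt (b := ENNReal.ofReal (Real.exp (lam * (4 * ∫ t, ‖u t‖)))) ?_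
      ENNReal.ofReal_lt_top
    exact liminf_le_of_frequently_le' (Frequently.of_forall hwnorm)
  have hbound : ∀ n, ∀ᵐ ω ∂P, ‖∏ᶠ k, (1 + v n (X k ω))‖ ≤ ‖D ω‖ := fun n => by
    filter_upwards [hfin] with ω hω
    simp only [hD]
    rw [hprod (hvB n) hω, hprod (g := fun t => ((2 * ‖u t‖ : ℝ) : ℂ)) huB' hω, norm_prod, norm_prod]
    refine Finset.prod_le_prod (fun k _ => norm_nonneg _) fun k _ => ?_
    have h2 : ‖(1 : ℂ) + ((2 * ‖u (X k ω)‖ : ℝ) : ℂ)‖ = 1 + 2 * ‖u (X k ω)‖ := by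
      rw [← Complex.ofReal_one, ← Complex.ofReal_add, Complex.norm_real, Real.norm_of_nonneg]
      positivity
    rw [h2]
    refine (norm_add_le _ _).trans ?_
    rw [norm_one]
    linarith [hvle n (X k ω)]
  have hulim := hlim huB hvB hvlim
  have hconv := tendsto_integral_of_dominated_convergence _ (fun n => (hsimple n).1.1)
    hDint.norm hbound hulim
  have hconv' : Tendsto (fun n => Complex.exp (lam * ∫ t, v n t)) atTop
      (𝓝 (Complex.exp (lam * ∫ t, u t))) := by
    refine (Complex.continuous_exp.tendsto _).comp (Tendsto.const_mul _ ?_)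
    exact tendsto_integral_of_dominated_convergence (fun t => 2 * ‖u t‖)
      (fun n => (v n).aestronglyMeasurable) (hint.norm.const_mul 2)
      (fun n => Eventually.of_forall (hvle n)) (Eventually.of_forall hvlim)
  refine ⟨?_, tendsto_nhds_unique hconv (by simpa only [(hsimple _).2] using hconv')⟩
  refine hDint.norm.mono'
    (aestronglyMeasurable_of_tendsto_ae _ (fun n => (hsimple n).1.1) hulim) ?_
  filter_upwards [hulim, ae_all_iff.2 hbound] with ω h1 h2
  exact le_of_tendsto' h1.norm h2

/-! ### Geometry of the interfering region -/

theorem streetPoint_add_pi (θ r t : ℝ) : streetPoint (θ + π) r t = streetPoint θ (-r) (-t) := by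
  simp [streetPoint]

theorem boresight_add_pi (θ : ℝ) : boresight (θ + π) = -boresight θ := by
  ext i; fin_cases i <;> simp [boresight]

/-- As `x / 0 = 0`, the left-hand side fails for `w = 0`. -/
theorem lt_div_iff_mul_lt_and_pos {κ x w : ℝ} (hw : 0 ≤ w) (hκ : 0 < κ) :
    κ < x / w ↔ κ * w < x ∧ 0 < w := by
  rcases hw.eq_or_lt with rfl | h
  · simp [hκ.le]
  · rw [lt_div_iff₀ h]; simp [h]

namespace RadarParams

variable (c : RadarParams)

/-- The distance from the ego radar to the point `streetPoint θ r t`. -/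
def egoDist (θ r t : ℝ) : ℝ :=
  √((t - c.r0 * Real.cos θ) ^ 2 + (r - c.r0 * Real.sin θ) ^ 2)

theorem norm_streetPoint_sub_ego (θ r t : ℝ) :
    ‖streetPoint θ r t - c.ego‖ = c.egoDist θ r t := by
  rw [EuclideanSpace.norm_eq, egoDist]
  congr 1
  simp [streetPoint, ego]
  linear_combination (r ^ 2 + t ^ 2 - c.r0 ^ 2) * Real.sin_sq_add_cos_sq θ

theorem sq_egoDist (θ r t : ℝ) : c.egoDist θ r t ^ 2 =
    (t - c.r0 * Real.cos θ) ^ 2 + (r - c.r0 * Real.sin θ) ^ 2 :=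
  Real.sq_sqrt (by positivity)

theorem egoDist_nonneg (θ r t : ℝ) : 0 ≤ c.egoDist θ r t := Real.sqrt_nonneg _

theorem abs_sub_le_egoDist (θ r t : ℝ) : |t - c.r0 * Real.cos θ| ≤ c.egoDist θ r t :=
  Real.abs_le_sqrt (by nlinarith [sq_nonneg (r - c.r0 * Real.sin θ)])

theorem cos_beam_pos {c : RadarParams} (hc : c.Valid) : 0 < Real.cos c.beam :=
  Real.cos_pos_of_mem_Ioo
    ⟨by linarith [hc.beam_pos, Real.pi_pos], by linarith [hc.beam_le, Real.pi_pos]⟩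

/-- The interference condition in terms of the distance to the ego radar and of the components of
the separation along the ego street and along the street of the vehicle. -/
theorem interferes_streetPoint_iff {c : RadarParams} (hc : c.Valid) (θ r t : ℝ) :
    c.Interferes θ (streetPoint θ r t) ↔
      Real.cos c.beam * c.egoDist θ r t < r * Real.sin θ + t * Real.cos θ - c.r0 ∧
      c.egoDist θ r t ≤ c.RB ∧
      Real.cos c.beam * c.egoDist θ r t < |t - c.r0 * Real.cos θ| := by
  have hκ : 0 < Real.cos c.beam := cos_beam_pos hc
  have h0 := c.egoDist_nonneg θ r t
  have e1 : inner ℝ (streetPoint θ r t - c.ego) (boresight 0) =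
      r * Real.sin θ + t * Real.cos θ - c.r0 := by
    simp [streetPoint, ego, boresight, PiLp.inner_apply, Fin.sum_univ_two]
  have e2 : inner ℝ (c.ego - streetPoint θ r t) (boresight θ) = -(t - c.r0 * Real.cos θ) := by
    simp [streetPoint, ego, boresight, PiLp.inner_apply, Fin.sum_univ_two]
    linear_combination -t * Real.sin_sq_add_cos_sq θ
  have e3 : inner ℝ (c.ego - streetPoint θ r t) (-boresight θ) = t - c.r0 * Real.cos θ := by
    rw [inner_neg_right, e2, neg_neg]
  have n1 := c.norm_streetPoint_sub_ego θ r t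
  have n2 : ‖c.ego - streetPoint θ r t‖ = c.egoDist θ r t := by rw [norm_sub_rev, n1]
  simp only [Interferes, radarSector, Set.mem_ofPred_eq, e1, e2, e3, n1, n2,
    lt_div_iff_mul_lt_and_pos h0 hκ, lt_abs]
  constructor
  · rintro ⟨⟨⟨h1, h2⟩, h3⟩, h4⟩
    exact ⟨h1, h3, by tauto⟩
  · rintro ⟨h1, h2, h3⟩
    have hpos : 0 < c.egoDist θ r t := by
      refine h0.lt_of_ne fun h => ?_
      have := c.abs_sub_le_egoDist θ r t
      rw [← h] at this h3
      rw [← lt_abs] at h3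
      linarith
    tauto

/-- The street parameters and positions of interfering vehicles. -/
def interferingRegion : Set ((ℝ × ℝ) × ℝ) :=
  {x | c.Interferes x.1.1 (streetPoint x.1.1 x.1.2 x.2)}

theorem measurable_egoDist : Measurable fun x : (ℝ × ℝ) × ℝ => c.egoDist x.1.1 x.1.2 x.2 := by
  unfold egoDist; fun_prop

theorem measurableSet_interferingRegion {c : RadarParams} (hc : c.Valid) :
    MeasurableSet c.interferingRegion := by
  have hm := c.measurable_egoDist
  have : c.interferingRegion = {x |
      Real.cos c.beam * c.egoDist x.1.1 x.1.2 x.2 <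
        x.1.2 * Real.sin x.1.1 + x.2 * Real.cos x.1.1 - c.r0} ∩
      ({x | c.egoDist x.1.1 x.1.2 x.2 ≤ c.RB} ∩
      {x | Real.cos c.beam * c.egoDist x.1.1 x.1.2 x.2 < |x.2 - c.r0 * Real.cos x.1.1|}) :=
    Set.ext fun x => interferes_streetPoint_iff hc _ _ _
  rw [this]
  refine (measurableSet_lt (by fun_prop) (by fun_prop)).inter
    ((measurableSet_le (by fun_prop) (by fun_prop)).inter
      (measurableSet_lt (by fun_prop) ?_))
  exact (show Continuous fun x : (ℝ × ℝ) × ℝ => |x.2 - c.r0 * Real.cos x.1.1| by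
    fun_prop).measurable

theorem abs_sub_le_RB {c : RadarParams} (hc : c.Valid) {x : (ℝ × ℝ) × ℝ}
    (hx : x ∈ c.interferingRegion) : |x.2 - c.r0 * Real.cos x.1.1| ≤ c.RB :=
  (c.abs_sub_le_egoDist _ x.1.2 _).trans ((interferes_streetPoint_iff hc _ _ _).1 hx).2.1

/-- With a beamwidth of at most `π / 4` a street meets the interfering region in a convex set:
the street makes an acute angle with the boresight of the ego radar for one of its two
orientations only, so that only the front or only the rear radars of its vehicles interfere. -/
theorem convex_interferingRegion_section {c : RadarParams} (hc : c.Valid) (θ r : ℝ) :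
    Convex ℝ {t | ((θ, r), t) ∈ c.interferingRegion} := by
  set κ := Real.cos c.beam with hκ
  have hκ2 : 1 / 2 ≤ κ ^ 2 := by
    have h1 : √2 / 2 ≤ κ := by
      rw [← Real.cos_pi_div_four]
      exact Real.cos_le_cos_of_nonneg_of_le_pi hc.beam_pos.le
        (by linarith [Real.pi_pos]) hc.beam_le
    have h2 : (√2 / 2) ^ 2 = 1 / 2 := by rw [div_pow, Real.sq_sqrt (by norm_num)]; norm_num
    rw [← h2]
    exact pow_le_pow_left₀ (by positivity) h1 2
  have hκ0 : 0 < κ := cos_beam_pos hc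
  have hconv : ConvexOn ℝ Set.univ (c.egoDist θ r) := by
    have : c.egoDist θ r = fun t => ‖AffineMap.lineMap (streetPoint θ r 0 - c.ego)
        (streetPoint θ r 1 - c.ego) t‖ := by
      funext t
      rw [← norm_streetPoint_sub_ego]
      congr 1
      ext i; fin_cases i <;> simp [AffineMap.lineMap_apply, streetPoint, ego] <;> ring
    rw [this]
    exact (convexOn_norm convex_univ).comp_affineMap (AffineMap.lineMap _ _)
  -- If the components of a unit vector along two directions exceed `1 / √2`, these directions form
  -- an acute angle. So the sign of `t - r0 cos θ` at an interfering position is that of `cos θ`.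
  have hsign : ∀ t σ : ℝ, σ ^ 2 = 1 →
      κ * c.egoDist θ r t < r * Real.sin θ + t * Real.cos θ - c.r0 →
      κ * c.egoDist θ r t < σ * (t - c.r0 * Real.cos θ) → 0 < σ * Real.cos θ := by
    intro t σ hσ h1 h2
    by_contra hcos
    rw [not_lt] at hcos
    have hw := c.sq_egoDist θ r t
    have hw0 := c.egoDist_nonneg θ r t
    set w := c.egoDist θ r t
    set s := t - c.r0 * Real.cos θ with hs
    set q := r - c.r0 * Real.sin θ with hq
    have hsplit : r * Real.sin θ + t * Real.cos θ - c.r0 = s * Real.cos θ + q * Real.sin θ := by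
      rw [hs, hq]; linear_combination c.r0 * Real.sin_sq_add_cos_sq θ
    have hκw : 0 ≤ κ * w := by positivity
    have h3 : s * Real.cos θ ≤ 0 := by
      have : s * Real.cos θ = (σ * s) * (σ * Real.cos θ) := by
        linear_combination -(s * Real.cos θ) * hσ
      rw [this]
      exact mul_nonpos_of_nonneg_of_nonpos (by linarith) hcos
    have h4 : κ * w < q * Real.sin θ := by linarith
    have h5 : (κ * w) ^ 2 < (q * Real.sin θ) ^ 2 := pow_lt_pow_left₀ h4 hκw two_ne_zero
    have h6 : (κ * w) ^ 2 < (σ * s) ^ 2 := pow_lt_pow_left₀ h2 hκw two_ne_zero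
    have h7 : (q * Real.sin θ) ^ 2 ≤ q ^ 2 := by
      rw [mul_pow]
      exact mul_le_of_le_one_right (sq_nonneg q) (Real.sin_sq_le_one θ)
    have h8 : w ^ 2 * (1 / 2) ≤ w ^ 2 * κ ^ 2 := mul_le_mul_of_nonneg_left hκ2 (sq_nonneg w)
    nlinarith
  obtain ⟨σ, hσ, hset⟩ : ∃ σ : ℝ, σ ^ 2 = 1 ∧ {t | ((θ, r), t) ∈ c.interferingRegion} =
      {t | κ * c.egoDist θ r t < r * Real.sin θ + t * Real.cos θ - c.r0 ∧
        c.egoDist θ r t ≤ c.RB ∧ κ * c.egoDist θ r t < σ * (t - c.r0 * Real.cos θ)} := by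
    rcases le_or_gt 0 (Real.cos θ) with h | h
    · refine ⟨1, by norm_num, Set.ext fun t => (interferes_streetPoint_iff hc θ r t).trans ?_⟩
      simp only [lt_abs, Set.mem_ofPred_eq, one_mul]
      refine ⟨fun ⟨h1, h2, h3⟩ => ⟨h1, h2, h3.resolve_right fun h4 => ?_⟩,
        fun ⟨h1, h2, h3⟩ => ⟨h1, h2, Or.inl h3⟩⟩
      have := hsign t (-1) (by norm_num) h1 (by linarith)
      linarith
    · refine ⟨-1, by norm_num, Set.ext fun t => (interferes_streetPoint_iff hc θ r t).trans ?_⟩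
      simp only [lt_abs, Set.mem_ofPred_eq, neg_one_mul]
      refine ⟨fun ⟨h1, h2, h3⟩ => ⟨h1, h2, h3.resolve_left fun h4 => ?_⟩,
        fun ⟨h1, h2, h3⟩ => ⟨h1, h2, Or.inr h3⟩⟩
      have := hsign t 1 (by norm_num) h1 (by linarith)
      linarith
  rw [hset]
  intro x hx y hy a b ha hb hab
  have hxy := hconv.2 (Set.mem_univ x) (Set.mem_univ y) ha hb hab
  simp only [smul_eq_mul] at hxy ⊢
  obtain ⟨x1, x2, x3⟩ := hx
  obtain ⟨y1, y2, y3⟩ := hy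
  have hb' : b = 1 - a := by linarith
  have hκxy := mul_le_mul_of_nonneg_left hxy hκ0.le
  have comb : ∀ {p q p' q' : ℝ}, p < q → p' < q' → a * p + b * p' < a * q + b * q' := by
    intro p q p' q' h h'
    rcases ha.eq_or_lt with rfl | ha0
    · have : b = 1 := by linarith
      subst this; linarith
    · nlinarith [mul_lt_mul_of_pos_left h ha0, mul_le_mul_of_nonneg_left h'.le hb]
  have g1 := comb x1 y1
  have g3 := comb x3 y3
  refine ⟨?_, ?_, ?_⟩
  · subst hb'; linarith
  · have := mul_le_mul_of_nonneg_left x2 ha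
    have := mul_le_mul_of_nonneg_left y2 hb
    subst hb'; linarith
  · subst hb'; linarith

end RadarParams

/-! ### The contribution of one vehicle -/

theorem integrableOn_abs_rpow {e : ℝ} (he : -1 < e) {R : ℝ} (hR : 0 ≤ R) :
    IntegrableOn (fun s : ℝ => |s| ^ e) (Set.Icc (-R) R) := by
  have h1 : IntervalIntegrable (fun s : ℝ => |s| ^ e) volume 0 R := by
    refine (intervalIntegral.intervalIntegrable_rpow' he (a := 0) (b := R)).congr fun s hs => ?_
    rw [Set.uIoc_of_le hR] at hs
    simp only [abs_of_pos hs.1]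
  have h2 : IntervalIntegrable (fun s : ℝ => |s| ^ e) volume (-R) 0 := by
    have := h1.comp_sub_left 0
    simp only [zero_sub, abs_neg, sub_zero] at this
    exact this.symm
  rw [integrableOn_Icc_iff_integrableOn_Ioc]
  exact (intervalIntegrable_iff_integrableOn_Ioc_of_le (by linarith)).1 (h2.trans h1)

namespace RadarParams

/-- The factor by which an interfering vehicle at distance `w` from the ego radar reduces the
conditional success probability: the Laplace transform at `β'` of the power `h w ^ (-α)`, which is
received only if the vehicle transmits. -/
def successFactor (c : RadarParams) (w : ℝ) : ℝ := c.p / (1 + c.β' * w ^ (-c.α)) + 1 - c.p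

open Classical in
/-- The factor contributed by a vehicle at position `x.2` of the street `x.1`; it is `1` for a
vehicle that does not interfere. -/
def vehicleFactor (c : RadarParams) (x : (ℝ × ℝ) × ℝ) : ℝ :=
  if x ∈ c.interferingRegion then c.successFactor (c.egoDist x.1.1 x.1.2 x.2) else 1

/-- The deviation from `1` of the `b`-th power of `vehicleFactor`. -/
def powerDeviation (c : RadarParams) (b : ℂ) (x : (ℝ × ℝ) × ℝ) : ℂ :=
  (c.vehicleFactor x : ℂ) ^ b - 1

variable {c : RadarParams}

theorem β'_nonneg (hc : c.Valid) : 0 ≤ c.β' := by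
  have := hc.σbar_pos
  have := Real.rpow_pos_of_pos hc.R_pos (-2 * c.α)
  have := hc.βSF_nonneg
  have : 0 < 1 - c.βSF := by linarith [hc.βSF_lt_one]
  unfold β'
  positivity

theorem one_div_le_successFactor (hc : c.Valid) {w : ℝ} (hw : 0 ≤ w) :
    1 / (1 + c.β' * w ^ (-c.α)) ≤ c.successFactor w := by
  have h0 : 0 ≤ c.β' * w ^ (-c.α) := mul_nonneg (β'_nonneg hc) (Real.rpow_nonneg hw _)
  have h1 : 1 / (1 + c.β' * w ^ (-c.α)) ≤ 1 := by
    rw [div_le_one (by positivity)]; linarith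
  have h2 : c.successFactor w = c.p * (1 / (1 + c.β' * w ^ (-c.α))) + 1 - c.p := by
    unfold successFactor; ring
  rw [h2]
  nlinarith [hc.p_le_one]

theorem successFactor_le_one (hc : c.Valid) {w : ℝ} (hw : 0 ≤ w) : c.successFactor w ≤ 1 := by
  have h0 : 0 ≤ c.β' * w ^ (-c.α) := mul_nonneg (β'_nonneg hc) (Real.rpow_nonneg hw _)
  have : c.p / (1 + c.β' * w ^ (-c.α)) ≤ c.p := div_le_self hc.p_nonneg (by linarith)
  unfold successFactor
  linarith

theorem successFactor_pos (hc : c.Valid) {w : ℝ} (hw : 0 ≤ w) : 0 < c.successFactor w := by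
  have h0 : 0 ≤ c.β' * w ^ (-c.α) := mul_nonneg (β'_nonneg hc) (Real.rpow_nonneg hw _)
  exact lt_of_lt_of_le (by positivity) (one_div_le_successFactor hc hw)

theorem vehicleFactor_pos (hc : c.Valid) (x : (ℝ × ℝ) × ℝ) : 0 < c.vehicleFactor x := by
  unfold vehicleFactor
  split_ifs
  · exact successFactor_pos hc (c.egoDist_nonneg _ _ _)
  · exact one_pos

theorem vehicleFactor_le_one (hc : c.Valid) (x : (ℝ × ℝ) × ℝ) : c.vehicleFactor x ≤ 1 := by
  unfold vehicleFactor
  split_ifs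
  · exact successFactor_le_one hc (c.egoDist_nonneg _ _ _)
  · exact le_rfl

theorem measurable_vehicleFactor (hc : c.Valid) : Measurable c.vehicleFactor := by
  unfold vehicleFactor
  refine Measurable.ite (measurableSet_interferingRegion hc) ?_ measurable_const
  have := c.measurable_egoDist
  unfold successFactor
  fun_prop

theorem measurable_powerDeviation (hc : c.Valid) (b : ℂ) : Measurable (c.powerDeviation b) := by
  have := measurable_vehicleFactor hc
  unfold powerDeviation
  fun_prop

theorem powerDeviation_of_notMem (b : ℂ) {x : (ℝ × ℝ) × ℝ} (hx : x ∉ c.interferingRegion) :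
    c.powerDeviation b x = 0 := by
  simp [powerDeviation, vehicleFactor, hx]

theorem powerDeviation_of_mem (b : ℂ) {x : (ℝ × ℝ) × ℝ} (hx : x ∈ c.interferingRegion) :
    c.powerDeviation b x = (c.successFactor (c.egoDist x.1.1 x.1.2 x.2) : ℂ) ^ b - 1 := by
  simp [powerDeviation, vehicleFactor, hx]

/-- A bound on `powerDeviation` that is integrable along the street and uniform over all streets. A
negative real part of `b` matters only for `p = 1`, when `vehicleFactor` may vanish like `w ^ α` as
`w → 0`; the distance `w` is at least the distance to the foot of the perpendicular from the ego
radar. -/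
theorem exists_bound_powerDeviation (hc : c.Valid) {b : ℂ} (hb : c.p < 1 ∨ -1 < c.α * b.re) :
    ∃ H : ℝ → ℝ, Integrable H ∧ ∀ x : (ℝ × ℝ) × ℝ, x.2 ≠ c.r0 * Real.cos x.1.1 →
      ‖c.powerDeviation b x‖ ≤ H (x.2 - c.r0 * Real.cos x.1.1) := by
  have hRB := hc.RB_pos
  obtain ⟨C₁, C₂, e, hC₁, hC₂, he, hbound⟩ : ∃ C₁ C₂ e : ℝ, 0 ≤ C₁ ∧ 0 ≤ C₂ ∧ -1 < e ∧
      ∀ s w : ℝ, 0 < s → s ≤ w → s ≤ c.RB → c.successFactor w ^ b.re ≤ C₁ + C₂ * s ^ e := by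
    rcases le_or_gt 0 b.re with h0 | h0
    · refine ⟨1, 0, 0, zero_le_one, le_rfl, by norm_num, fun s w hs hsw _ => ?_⟩
      have hw : 0 ≤ w := hs.le.trans hsw
      have := Real.rpow_le_one (successFactor_pos hc hw).le (successFactor_le_one hc hw) h0
      linarith
    rcases lt_or_ge c.p 1 with hp | hp
    · refine ⟨(1 - c.p) ^ b.re, 0, 0, Real.rpow_nonneg (by linarith) _, le_rfl, by norm_num,
        fun s w hs hsw _ => ?_⟩
      have hw : 0 ≤ w := hs.le.trans hsw
      have h1 : 1 - c.p ≤ c.successFactor w := by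
        have h0 : 0 ≤ c.β' * w ^ (-c.α) := mul_nonneg (β'_nonneg hc) (Real.rpow_nonneg hw _)
        have : 0 ≤ c.p / (1 + c.β' * w ^ (-c.α)) := div_nonneg hc.p_nonneg (by linarith)
        unfold successFactor; linarith
      have := Real.rpow_le_rpow_of_nonpos (by linarith) h1 h0.le
      linarith
    · refine ⟨0, (c.RB ^ c.α + c.β') ^ (-b.re), c.α * b.re, le_rfl,
        Real.rpow_nonneg (add_nonneg (Real.rpow_nonneg hRB.le _) (β'_nonneg hc)) _,
        hb.resolve_left (not_lt.2 hp), fun s w hs hsw hsR => ?_⟩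
      have hw : 0 ≤ w := hs.le.trans hsw
      have hβ := β'_nonneg hc
      have hsα : 0 < s ^ (-c.α) := Real.rpow_pos_of_pos hs _
      -- `1 + β' w ^ (-α)` is at most a multiple of `s ^ (-α)` for `s ≤ w` and `s ≤ RB`
      have h1 : w ^ (-c.α) ≤ s ^ (-c.α) :=
        Real.rpow_le_rpow_of_nonpos hs hsw (by linarith [hc.α_pos])
      have h2 : 1 ≤ c.RB ^ c.α * s ^ (-c.α) := by
        rw [Real.rpow_neg hs.le, ← div_eq_mul_inv, one_le_div (Real.rpow_pos_of_pos hs _)]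
        exact Real.rpow_le_rpow hs.le hsR hc.α_pos.le
      have h3 : 1 + c.β' * w ^ (-c.α) ≤ (c.RB ^ c.α + c.β') * s ^ (-c.α) := by
        nlinarith [mul_le_mul_of_nonneg_left h1 hβ]
      have h4 : 0 < 1 + c.β' * w ^ (-c.α) := by
        have := mul_nonneg hβ (Real.rpow_nonneg hw (-c.α)); linarith
      calc c.successFactor w ^ b.re ≤ (1 / (1 + c.β' * w ^ (-c.α))) ^ b.re :=
            Real.rpow_le_rpow_of_nonpos (by positivity) (one_div_le_successFactor hc hw) h0.le
        _ = (1 + c.β' * w ^ (-c.α)) ^ (-b.re) := by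
            rw [one_div, Real.inv_rpow h4.le, Real.rpow_neg h4.le]
        _ ≤ ((c.RB ^ c.α + c.β') * s ^ (-c.α)) ^ (-b.re) :=
            Real.rpow_le_rpow h4.le h3 (by linarith)
        _ = 0 + (c.RB ^ c.α + c.β') ^ (-b.re) * s ^ (c.α * b.re) := by
            rw [Real.mul_rpow (add_nonneg (Real.rpow_nonneg hRB.le _) hβ) hsα.le,
              ← Real.rpow_mul hs.le]
            ring_nf
  refine ⟨(Set.Icc (-c.RB) c.RB).indicator fun s => 1 + C₁ + C₂ * |s| ^ e, ?_, fun x hx => ?_⟩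
  · rw [integrable_indicator_iff measurableSet_Icc]
    exact ((integrable_const _).add ((integrableOn_abs_rpow he hRB.le).const_mul C₂))
  · by_cases hmem : x ∈ c.interferingRegion
    · have habs := abs_sub_le_RB hc hmem
      rw [Set.indicator_of_mem (Set.mem_Icc.2 (abs_le.1 habs)), powerDeviation_of_mem b hmem]
      have hw := c.egoDist_nonneg x.1.1 x.1.2 x.2
      have h1 := hbound |x.2 - c.r0 * Real.cos x.1.1| _ (abs_pos.2 (sub_ne_zero.2 hx))
        (c.abs_sub_le_egoDist x.1.1 x.1.2 x.2) habs
      refine (norm_sub_le _ _).trans ?_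
      rw [Complex.norm_cpow_eq_rpow_re_of_pos (successFactor_pos hc hw), norm_one]
      linarith
    · rw [powerDeviation_of_notMem b hmem, norm_zero]
      refine Set.indicator_nonneg (fun s _ => ?_) _
      positivity

/-- The deviations are integrable along every street, with a bound uniform over the streets. -/
theorem integrable_powerDeviation (hc : c.Valid) {b : ℂ} (hb : c.p < 1 ∨ -1 < c.α * b.re) :
    ∃ K : ℝ, ∀ l : ℝ × ℝ, Integrable (fun t => c.powerDeviation b (l, t)) ∧
      ∫ t, ‖c.powerDeviation b (l, t)‖ ≤ K := by
  obtain ⟨H, hH, hle⟩ := exists_bound_powerDeviation hc hb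
  refine ⟨∫ s, H s, fun l => ?_⟩
  have hH' := hH.comp_sub_right (c.r0 * Real.cos l.1)
  have hae : ∀ᵐ t : ℝ, ‖c.powerDeviation b (l, t)‖ ≤ H (t - c.r0 * Real.cos l.1) := by
    have : ∀ᵐ t : ℝ, t ≠ c.r0 * Real.cos l.1 := by simp [ae_iff]
    exact this.mono fun t ht => hle (l, t) ht
  refine ⟨hH'.mono' ((measurable_powerDeviation hc b).comp
    measurable_prodMk_left).aestronglyMeasurable hae, ?_⟩
  rw [← integral_sub_right_eq_self H (c.r0 * Real.cos l.1)]
  exact integral_mono_of_nonneg (Eventually.of_forall fun _ => norm_nonneg _) hH' hae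

end RadarParams

/-! ### The line integrals in crossing coordinates -/

theorem ae_eq_Ioc_of_convex {s : Set ℝ} (hs : Convex ℝ s) (hb : Bornology.IsBounded s) :
    s =ᵐ[volume] Set.Ioc (sInf s) (sSup s) := by
  rcases s.eq_empty_or_nonempty with rfl | hne
  · simp
  refine EventuallyLE.antisymm ?_ ?_
  · refine LE.le.eventuallyLE (subset_Icc_csInf_csSup hb.bddBelow hb.bddAbove) |>.trans ?_
    exact Ioc_ae_eq_Icc.symm.le
  · refine Ioo_ae_eq_Ioc.symm.le.trans ?_
    exact LE.le.eventuallyLE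
      (IsConnected.Ioo_csInf_csSup_subset ⟨hne, hs.isPreconnected⟩ hb.bddBelow hb.bddAbove)

namespace RadarParams

variable {c : RadarParams}

/-- The interfering part of the ego street is the interval of length `RB` ahead of the ego
radar. -/
theorem integral_powerDeviation_ego (hc : c.Valid) (b : ℂ) :
    ∫ t, c.powerDeviation b ((0, 0), t) = -∫ v in (0 : ℝ)..c.RB,
      (1 - ((c.p / (1 + c.β' * v ^ (-c.α)) + 1 - c.p : ℝ) : ℂ) ^ b) := by
  have hκ1 : Real.cos c.beam < 1 := by
    rw [← Real.cos_zero]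
    exact Real.cos_lt_cos_of_nonneg_of_le_pi le_rfl
      (by linarith [hc.beam_le, Real.pi_pos]) hc.beam_pos
  have hκ0 : 0 < Real.cos c.beam := cos_beam_pos hc
  have hd : ∀ v, c.egoDist 0 0 (v + c.r0) = |v| := fun v => by
    simp [egoDist, Real.sqrt_sq_eq_abs]
  have hmem : ∀ v, ((0, 0), v + c.r0) ∈ c.interferingRegion ↔ v ∈ Set.Ioc 0 c.RB := fun v => by
    refine (interferes_streetPoint_iff hc 0 0 (v + c.r0)).trans ?_
    rw [hd]
    simp only [Real.sin_zero, Real.cos_zero, mul_zero, mul_one, zero_add, add_sub_cancel_right,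
      Set.mem_Ioc]
    constructor
    · rintro ⟨h1, h2, -⟩
      have hv : 0 < v := by nlinarith [abs_nonneg v]
      exact ⟨hv, by rwa [abs_of_pos hv] at h2⟩
    · rintro ⟨h1, h2⟩
      rw [abs_of_pos h1]
      exact ⟨by nlinarith, h2, by nlinarith⟩
  rw [← integral_add_right_eq_self _ c.r0, intervalIntegral.integral_of_le hc.RB_pos.le,
    ← integral_neg, ← integral_indicator measurableSet_Ioc]
  congr 1 with v
  by_cases hv : v ∈ Set.Ioc 0 c.RB
  · rw [Set.indicator_of_mem hv, powerDeviation_of_mem b ((hmem v).2 hv)]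
    simp only [hd, abs_of_pos hv.1, successFactor]
    ring
  · rw [Set.indicator_of_notMem hv, powerDeviation_of_notMem b (fun h => hv ((hmem v).1 h))]

/-- The substitution `t = ± v + r cos θ / sin θ`, together with the fact that the interfering
distances form an interval. -/
theorem integral_powerDeviation_line (hc : c.Valid) (b : ℂ) {θ : ℝ} (hθ : Real.sin θ ≠ 0) (r : ℝ) :
    ∫ t, c.powerDeviation b ((θ, r), t) = -∫ v in (c.aB θ r)..(c.bB θ r),
      (1 - ((c.p / (1 + c.β' * (c.wB θ r v) ^ (-c.α)) + 1 - c.p : ℝ) : ℂ) ^ b) := by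
  obtain ⟨σ, hσ, hσ', hσabs⟩ : ∃ σ : ℝ, (σ = 1 ∨ σ = -1) ∧
      (if 0 ≤ Real.cos θ then (1 : ℝ) else -1) = σ ∧ |Real.cos θ| = σ * Real.cos θ := by
    by_cases h : 0 ≤ Real.cos θ
    · exact ⟨1, Or.inl rfl, if_pos h, by rw [abs_of_nonneg h, one_mul]⟩
    · exact ⟨-1, Or.inr rfl, if_neg h, by rw [abs_of_neg (not_le.1 h), neg_one_mul]⟩
  have hσ2 : σ ^ 2 = 1 := by rcases hσ with rfl | rfl <;> norm_num
  set t₀ := r * Real.cos θ / Real.sin θ with ht₀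
  have hcross : ∀ v, crossPoint θ r v = streetPoint θ r (σ * v + t₀) := fun v => by
    have e1 : t₀ * Real.sin θ = r * Real.cos θ := by rw [ht₀]; field_simp
    have e2 : r / Real.sin θ = r * Real.sin θ + t₀ * Real.cos θ := by
      rw [ht₀]; field_simp; rw [Real.sin_sq_add_cos_sq, mul_one]
    unfold crossPoint
    rw [hσ']
    ext i; fin_cases i
    · simp [streetPoint, boresight]; linear_combination e1
    · simp [streetPoint, boresight]; linear_combination e2
  have hw : ∀ v, c.egoDist θ r (σ * v + t₀) = c.wB θ r v := fun v => by
    rw [← norm_streetPoint_sub_ego, ← hcross, EuclideanSpace.norm_eq, wB, hσabs]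
    unfold crossPoint
    rw [hσ']
    congr 1
    simp [boresight, ego]
    linear_combination v ^ 2 * Real.sin θ ^ 2 * hσ2
  have hsec : ∀ v, ((θ, r), σ * v + t₀) ∈ c.interferingRegion ↔ v ∈ c.interferingSection θ r :=
    fun v => by simp only [interferingRegion, interferingSection, Set.mem_ofPred_eq, hcross]
  have hsec' : c.interferingSection θ r =
      (fun v => σ * v + t₀) ⁻¹' {t | ((θ, r), t) ∈ c.interferingRegion} :=
    Set.ext fun v => (hsec v).symm
  have hconv : Convex ℝ (c.interferingSection θ r) := by
    rw [hsec']
    intro x hx y hy p q hp hq hpq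
    have := convex_interferingRegion_section hc θ r hx hy hp hq hpq
    simp only [Set.mem_preimage]
    convert this using 1
    simp only [smul_eq_mul]
    linear_combination -t₀ * hpq
  have hbdd : Bornology.IsBounded (c.interferingSection θ r) := by
    refine (Metric.isBounded_Icc (-(c.RB + |t₀ - c.r0 * Real.cos θ|))
      (c.RB + |t₀ - c.r0 * Real.cos θ|)).subset fun v hv => ?_
    have h1 := abs_sub_le_RB hc ((hsec v).2 hv)
    have h2 : |v| = |σ * v| := by
      rw [abs_mul]; rcases hσ with rfl | rfl <;> simp
    rw [Set.mem_Icc, ← abs_le, h2]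
    have h3 : σ * v = (σ * v + t₀ - c.r0 * Real.cos θ) - (t₀ - c.r0 * Real.cos θ) := by ring
    rw [h3]
    exact (abs_sub _ _).trans (by simpa using h1)
  have hms : MeasurableSet (c.interferingSection θ r) := hconv.ordConnected.measurableSet
  have hsubst : ∫ t, c.powerDeviation b ((θ, r), t) =
      ∫ v, c.powerDeviation b ((θ, r), σ * v + t₀) := by
    rw [← integral_add_right_eq_self _ t₀]
    rcases hσ with rfl | rfl
    · simp
    · rw [← integral_neg_eq_self]; simp
  have hle : c.aB θ r ≤ c.bB θ r := Real.sInf_le_sSup _ hbdd.bddBelow hbdd.bddAbove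
  rw [hsubst, intervalIntegral.integral_of_le hle, ← integral_neg, aB, bB,
    ← setIntegral_congr_set (ae_eq_Ioc_of_convex hconv hbdd), ← integral_indicator hms]
  congr 1 with v
  by_cases hv : v ∈ c.interferingSection θ r
  · rw [Set.indicator_of_mem hv, powerDeviation_of_mem b ((hsec v).2 hv)]
    simp only [hw, successFactor]
    ring
  · rw [Set.indicator_of_notMem hv, powerDeviation_of_notMem b (fun h => hv ((hsec v).1 h))]

/-! ### The average over the streets -/

/-- The expectation of the `b`-th power of the product of the factors of the vehicles on a street
with parameters `l`. -/
def streetMoment (c : RadarParams) (b : ℂ) (l : ℝ × ℝ) : ℂ :=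
  Complex.exp (c.lam * ∫ t, c.powerDeviation b (l, t))

theorem measurable_streetMoment (hc : c.Valid) (b : ℂ) : Measurable (c.streetMoment b) := by
  have := ((measurable_powerDeviation hc b).stronglyMeasurable.integral_prod_right'
    (ν := (volume : Measure ℝ))).measurable
  unfold streetMoment
  fun_prop

theorem exists_norm_streetMoment_le (hc : c.Valid) {b : ℂ} (hb : c.p < 1 ∨ -1 < c.α * b.re) :
    ∃ K : ℝ, ∀ l, ‖c.streetMoment b l‖ ≤ K := by
  obtain ⟨K, hK⟩ := integrable_powerDeviation hc hb
  refine ⟨Real.exp (c.lam * K), fun l => ?_⟩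
  rw [streetMoment]
  refine (Complex.norm_exp_le_exp_norm _).trans (Real.exp_le_exp.2 ?_)
  rw [norm_mul, Complex.norm_real, Real.norm_of_nonneg hc.lam_pos.le]
  exact mul_le_mul_of_nonneg_left ((norm_integral_le_integral_norm _).trans (hK l).2)
    hc.lam_pos.le

/-- `(θ + π, r)` and `(θ, -r)` are the same street. -/
theorem streetMoment_add_pi (b : ℂ) (θ r : ℝ) :
    c.streetMoment b (θ + π, r) = c.streetMoment b (θ, -r) := by
  have hd : ∀ t, c.egoDist (θ + π) r t = c.egoDist θ (-r) (-t) := fun t => by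
    rw [← norm_streetPoint_sub_ego, ← norm_streetPoint_sub_ego, streetPoint_add_pi]
  have hmem : ∀ t, ((θ + π, r), t) ∈ c.interferingRegion ↔
      ((θ, -r), -t) ∈ c.interferingRegion := fun t => by
    simp only [interferingRegion, Interferes, Set.mem_ofPred_eq, streetPoint_add_pi,
      boresight_add_pi, neg_neg]
    tauto
  unfold streetMoment
  rw [← integral_neg_eq_self fun t => c.powerDeviation b ((θ, -r), t)]
  have hf : ∀ t, c.vehicleFactor ((θ + π, r), t) = c.vehicleFactor ((θ, -r), -t) := fun t => by
    unfold vehicleFactor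
    by_cases h : ((θ, -r), -t) ∈ c.interferingRegion
    · rw [if_pos h, if_pos ((hmem t).2 h), hd]
    · rw [if_neg h, if_neg (fun h' => h ((hmem t).1 h'))]
  simp only [powerDeviation, hf]

/-- The uniform average over the street parameters `[0, π) × [-R_g, R_g]` equals the average
over `(0, 2π) × (0, R_g)`, because `(θ + π, r)` and `(θ, -r)` are the same street. -/
theorem integral_streetMoment (hc : c.Valid) {b : ℂ} (hb : c.p < 1 ∨ -1 < c.α * b.re) :
    ∫ l, c.streetMoment b l ∂(cond volume c.streetDomain) = (1 / (2 * (π : ℂ) * (c.Rg : ℂ))) *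
      ∫ r in (0 : ℝ)..c.Rg, ∫ θ in (0 : ℝ)..(2 * π),
        Complex.exp (-(c.lam : ℂ) * ∫ v in (c.aB θ r)..(c.bB θ r),
          (1 - ((c.p / (1 + c.β' * (c.wB θ r v) ^ (-c.α)) + 1 - c.p : ℝ) : ℂ) ^ b)) := by
  have hRg := hc.Rg_pos
  have hπ := Real.pi_pos
  obtain ⟨K, hK⟩ := exists_norm_streetMoment_le hc hb
  have hm := measurable_streetMoment hc b
  have hvol : volume c.streetDomain = ENNReal.ofReal (2 * π * c.Rg) := by
    rw [streetDomain, Measure.volume_eq_prod, Measure.prod_prod, Real.volume_Ico, Real.volume_Icc,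
      ← ENNReal.ofReal_mul (by linarith)]
    congr 1; ring
  have hint : IntegrableOn (c.streetMoment b) c.streetDomain := by
    refine IntegrableOn.of_bound (by rw [hvol]; exact ENNReal.ofReal_lt_top)
      hm.aestronglyMeasurable K (Eventually.of_forall hK)
  have hii : ∀ (r x y : ℝ), IntervalIntegrable (fun θ => c.streetMoment b (θ, r)) volume x y :=
    fun r x y => (intervalIntegrable_const (c := K)).mono_fun
      (hm.comp measurable_prodMk_right).aestronglyMeasurable
      (Eventually.of_forall fun θ => (hK _).trans (le_abs_self K))
  have hm' : Measurable fun r => ∫ θ in (0 : ℝ)..π, c.streetMoment b (θ, r) := by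
    simp_rw [intervalIntegral.integral_of_le hπ.le]
    exact (hm.stronglyMeasurable.integral_prod_left'
      (μ := volume.restrict (Set.Ioc 0 π))).measurable
  have hii' : ∀ x y, IntervalIntegrable (fun r => ∫ θ in (0 : ℝ)..π, c.streetMoment b (θ, r))
      volume x y := fun x y =>
    (intervalIntegrable_const (c := K * |π - 0|)).mono_fun hm'.aestronglyMeasurable
      (Eventually.of_forall fun r =>
        (intervalIntegral.norm_integral_le_of_norm_le_const fun θ _ => hK _).trans (le_abs_self _))
  -- the right-hand side in terms of `streetMoment`
  have hin : ∀ r : ℝ, ∫ θ in (0 : ℝ)..(2 * π),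
      Complex.exp (-(c.lam : ℂ) * ∫ v in (c.aB θ r)..(c.bB θ r),
        (1 - ((c.p / (1 + c.β' * (c.wB θ r v) ^ (-c.α)) + 1 - c.p : ℝ) : ℂ) ^ b)) =
      (∫ θ in (0 : ℝ)..π, c.streetMoment b (θ, r)) +
        ∫ θ in (0 : ℝ)..π, c.streetMoment b (θ, -r) := fun r => by
    have hsin : ∀ᵐ θ : ℝ, Real.sin θ ≠ 0 := by
      have : {θ : ℝ | ¬ Real.sin θ ≠ 0} = Set.range fun n : ℤ => n * π := by
        ext θ; simp [Real.sin_eq_zero_iff]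
      rw [ae_iff, this]
      exact (Set.countable_range _).measure_zero _
    have h1 : ∫ θ in (0 : ℝ)..(2 * π),
        Complex.exp (-(c.lam : ℂ) * ∫ v in (c.aB θ r)..(c.bB θ r),
          (1 - ((c.p / (1 + c.β' * (c.wB θ r v) ^ (-c.α)) + 1 - c.p : ℝ) : ℂ) ^ b)) =
        ∫ θ in (0 : ℝ)..(2 * π), c.streetMoment b (θ, r) := by
      refine intervalIntegral.integral_congr_ae (hsin.mono fun θ hθ _ => ?_)
      rw [streetMoment, integral_powerDeviation_line hc b hθ r]
      ring_nf
    have h2 := intervalIntegral.integral_comp_add_right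
      (fun θ => c.streetMoment b (θ, r)) (a := 0) (b := π) π
    rw [h1, ← intervalIntegral.integral_add_adjacent_intervals (hii r 0 π) (hii r π (2 * π))]
    simp_rw [streetMoment_add_pi] at h2
    rw [h2, zero_add, two_mul]
  simp_rw [hin]
  have hneg := intervalIntegral.integral_comp_neg (a := 0) (b := c.Rg)
    fun r => ∫ θ in (0 : ℝ)..π, c.streetMoment b (θ, r)
  have hii'' : IntervalIntegrable (fun r => ∫ θ in (0 : ℝ)..π, c.streetMoment b (θ, -r))
      volume 0 c.Rg := by
    have := (hii' 0 (-c.Rg)).comp_sub_left 0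
    simpa using this
  rw [intervalIntegral.integral_add (hii' _ _) hii'', hneg, neg_zero, add_comm,
    intervalIntegral.integral_add_adjacent_intervals (hii' _ _) (hii' _ _),
    ProbabilityTheory.cond, integral_smul_measure, hvol]
  have hint' := hint
  rw [IntegrableOn, streetDomain, Measure.volume_eq_prod, ← Measure.prod_restrict] at hint'
  rw [streetDomain, Measure.volume_eq_prod, ← Measure.prod_restrict, integral_prod_symm _ hint',
    intervalIntegral.integral_of_le (by linarith), integral_Icc_eq_integral_Ioc]
  simp_rw [intervalIntegral.integral_of_le hπ.le, integral_Ico_eq_integral_Ioo,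
    integral_Ioc_eq_integral_Ioo]
  rw [ENNReal.toReal_inv, ENNReal.toReal_ofReal (by positivity), Complex.real_smul]
  push_cast
  rw [one_div]

end RadarParams

/-! ### The conditional success probability -/

namespace RadarParams

variable {c : RadarParams}

open Classical in
/-- The normalised mean power of the interference from a transmitting vehicle at
position `x.2` of the street `x.1`; it is `0` for a vehicle that does not interfere. -/
def vehicleLoad (c : RadarParams) (x : (ℝ × ℝ) × ℝ) : ℝ :=
  if x ∈ c.interferingRegion then c.β' * c.egoDist x.1.1 x.1.2 x.2 ^ (-c.α) else 0

theorem measurable_vehicleLoad (hc : c.Valid) : Measurable c.vehicleLoad := by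
  unfold vehicleLoad
  refine Measurable.ite (measurableSet_interferingRegion hc) ?_ measurable_const
  have := c.measurable_egoDist
  fun_prop

theorem vehicleLoad_nonneg (hc : c.Valid) (x : (ℝ × ℝ) × ℝ) : 0 ≤ c.vehicleLoad x := by
  unfold vehicleLoad
  split_ifs
  · exact mul_nonneg (β'_nonneg hc) (Real.rpow_nonneg (c.egoDist_nonneg _ _ _) _)
  · exact le_rfl

theorem vehicleFactor_eq (x : (ℝ × ℝ) × ℝ) :
    c.vehicleFactor x = c.p * (1 / (1 + c.vehicleLoad x)) + (1 - c.p) := by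
  unfold vehicleFactor vehicleLoad successFactor
  split_ifs <;> ring

/-- The product of the factors of vehicles at the positions `x.2 0, x.2 1, ...` of the street with
parameters `x.1`, as the infimum of the partial products. As the
factors lie in `[0, 1]`, this is the limit of the partial products. -/
def positionsFactor (c : RadarParams) (x : (ℝ × ℝ) × (ℕ → ℝ)) : ℝ :=
  ⨅ n : ℕ, ∏ k ∈ Finset.range n, c.vehicleFactor (x.1, x.2 k)

theorem measurable_positionsFactor (hc : c.Valid) : Measurable c.positionsFactor := by
  refine Measurable.iInf fun n => Finset.measurable_fun_prod _ fun k _ => ?_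
  exact (measurable_vehicleFactor hc).comp
    (measurable_fst.prodMk ((measurable_pi_apply k).comp measurable_snd))

end RadarParams

namespace RadarNetwork

variable {c : RadarParams} {S : Type*} (N : RadarNetwork c S)

/-- The information in the sources of randomness in `T`. -/
@[reducible] def sigmaOf (T : Set (RadarSource c)) : MeasurableSpace S := ⨆ i ∈ T, N.sigma i

/-- The street parameters and the position of the `k`-th vehicle on street `j`. -/
def place (j : c.Street) (k : ℕ) (ω : S) : (ℝ × ℝ) × ℝ := (N.street j ω, N.pos j k ω)

/-- The sources of randomness of the geometry: the streets and the vehicle positions. -/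
def geometrySources (c : RadarParams) : Set (RadarSource c) :=
  Set.range RadarSource.line ∪ Set.range RadarSource.pos

/-- The normalised interference power received from the `k`-th vehicle on street `j`, so that
`SF > β_SF` means that the radar cross-section exceeds `σbar` times the total. The absolute value of
the fading, which is almost surely nonnegative, makes the load nonnegative everywhere. -/
def load (a : c.Street × ℕ) (ω : S) : ℝ :=
  c.vehicleLoad (N.place a.1 a.2 ω) * (if N.transmits a.1 a.2 ω then 1 else 0) *
    |N.fading a.1 a.2 ω|

/-- The product of the factors of all vehicles on street `j`. -/
def streetFactor (j : c.Street) (ω : S) : ℝ :=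
  c.positionsFactor (N.street j ω, fun k => N.pos j k ω)

variable {N}

theorem sigma_le_sigmaOf {T : Set (RadarSource c)} {i : RadarSource c} (hi : i ∈ T) :
    N.sigma i ≤ N.sigmaOf T := le_biSup N.sigma hi

theorem sigmaOf_mono {T T' : Set (RadarSource c)} (h : T ⊆ T') : N.sigmaOf T ≤ N.sigmaOf T' :=
  biSup_mono fun _ hi => h hi

theorem geometry_eq_sigmaOf : N.geometry = N.sigmaOf (geometrySources c) := by
  rw [geometry, sigmaOf, geometrySources, iSup_union, iSup_range, iSup_range]

theorem measurable_street {T : Set (RadarSource c)} {j : c.Street}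
    (hT : ∀ i, j = some i → RadarSource.line i ∈ T) : Measurable[N.sigmaOf T] (N.street j) := by
  cases j with
  | none => exact @measurable_const _ _ _ (N.sigmaOf T) _
  | some i => exact (comap_measurable (N.line i)).mono (sigma_le_sigmaOf (hT i rfl)) le_rfl

theorem measurable_place {T : Set (RadarSource c)} {j : c.Street}
    (hT : ∀ i, j = some i → RadarSource.line i ∈ T) (hpos : RadarSource.pos j ∈ T) (k : ℕ) :
    Measurable[N.sigmaOf T] (N.place j k) := by
  have h1 : Measurable[N.sigmaOf T] (fun ω k => N.pos j k ω) :=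
    (comap_measurable (fun ω k => N.pos j k ω)).mono (sigma_le_sigmaOf hpos) le_rfl
  exact (measurable_street hT).prodMk ((measurable_pi_apply k).comp h1)

theorem line_mem_geometrySources (i : Fin (c.nB - 1)) :
    RadarSource.line i ∈ geometrySources c := Or.inl ⟨i, rfl⟩

theorem pos_mem_geometrySources (j : c.Street) :
    RadarSource.pos j ∈ geometrySources c := Or.inr ⟨j, rfl⟩

theorem fading_notMem_geometrySources (j : c.Street) (k : ℕ) :
    RadarSource.fading j k ∉ geometrySources c := by rintro (⟨_, h⟩ | ⟨_, h⟩) <;> cases h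

theorem transmits_notMem_geometrySources (j : c.Street) (k : ℕ) :
    RadarSource.transmits j k ∉ geometrySources c := by rintro (⟨_, h⟩ | ⟨_, h⟩) <;> cases h

theorem rcs_notMem_geometrySources : RadarSource.rcs ∉ geometrySources c := by
  rintro (⟨_, h⟩ | ⟨_, h⟩) <;> cases h

theorem measurable_place_of_geometry {T : Set (RadarSource c)} (hT : geometrySources c ⊆ T)
    (j : c.Street) (k : ℕ) : Measurable[N.sigmaOf T] (N.place j k) :=
  measurable_place (fun i _ => hT (line_mem_geometrySources i)) (hT (pos_mem_geometrySources j)) k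

theorem measurable_indicator_transmits {T : Set (RadarSource c)} {j : c.Street} {k : ℕ}
    (hT : RadarSource.transmits j k ∈ T) :
    Measurable[N.sigmaOf T] fun ω => if N.transmits j k ω then (1 : ℝ) else 0 := by
  have h1 : Measurable[N.sigmaOf T] (N.transmits j k) :=
    (comap_measurable (N.transmits j k)).mono (sigma_le_sigmaOf hT) le_rfl
  exact (measurable_of_countable fun τ : Bool => if τ then (1 : ℝ) else 0).comp h1

theorem measurable_load (hc : c.Valid) {T : Set (RadarSource c)} (hT : geometrySources c ⊆ T)
    {a : c.Street × ℕ} (hf : RadarSource.fading a.1 a.2 ∈ T)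
    (ht : RadarSource.transmits a.1 a.2 ∈ T) : Measurable[N.sigmaOf T] (N.load a) := by
  have h1 : Measurable[N.sigmaOf T] (N.fading a.1 a.2) :=
    (comap_measurable (N.fading a.1 a.2)).mono (sigma_le_sigmaOf hf) le_rfl
  have h2 := (RadarParams.measurable_vehicleLoad hc).comp
    (measurable_place_of_geometry (N := N) hT a.1 a.2)
  exact (h2.mul (measurable_indicator_transmits ht)).mul (measurable_abs.comp h1)

theorem load_nonneg (hc : c.Valid) (a : c.Street × ℕ) (ω : S) : 0 ≤ N.load a ω := by
  unfold load
  have := RadarParams.vehicleLoad_nonneg hc (N.place a.1 a.2 ω)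
  split_ifs <;> positivity

theorem measurable_streetFactor (hc : c.Valid) {T : Set (RadarSource c)} {j : c.Street}
    (hT : ∀ i, j = some i → RadarSource.line i ∈ T) (hpos : RadarSource.pos j ∈ T) :
    Measurable[N.sigmaOf T] (N.streetFactor j) := by
  have h1 : Measurable[N.sigmaOf T] (fun ω k => N.pos j k ω) :=
    (comap_measurable (fun ω k => N.pos j k ω)).mono (sigma_le_sigmaOf hpos) le_rfl
  exact (RadarParams.measurable_positionsFactor hc).comp ((measurable_street hT).prodMk h1)

theorem tendsto_streetFactor (hc : c.Valid) (j : c.Street) (ω : S) :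
    Tendsto (fun n : ℕ => ∏ k ∈ Finset.range n, c.vehicleFactor (N.place j k ω)) atTop
      (𝓝 (N.streetFactor j ω)) := by
  refine tendsto_atTop_ciInf (antitone_nat_of_succ_le fun n => ?_) ⟨0, ?_⟩
  · rw [Finset.prod_range_succ]
    exact mul_le_of_le_one_right
      (Finset.prod_nonneg fun k _ => (RadarParams.vehicleFactor_pos hc _).le)
      (RadarParams.vehicleFactor_le_one hc _)
  · rintro _ ⟨n, rfl⟩
    exact Finset.prod_nonneg fun k _ => (RadarParams.vehicleFactor_pos hc _).le

variable [MeasurableSpace S] {P : Measure S}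

theorem IsBLCP.sigma_le (hN : N.IsBLCP P) (i : RadarSource c) :
    N.sigma i ≤ (inferInstance : MeasurableSpace S) := by
  cases i with
  | line i => exact (hN.measurable_line i).comap_le
  | pos j => exact (measurable_pi_lambda _ fun k => (hN.pos_poisson j).measurable k).comap_le
  | fading j k => exact (hN.measurable_fading j k).comap_le
  | transmits j k => exact (hN.measurable_transmits j k).comap_le
  | rcs => exact hN.measurable_rcs.comap_le

theorem IsBLCP.sigmaOf_le (hN : N.IsBLCP P) (T : Set (RadarSource c)) :
    N.sigmaOf T ≤ (inferInstance : MeasurableSpace S) := iSup₂_le fun i _ => hN.sigma_le i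

/-- A random variable is independent of the sources of randomness from which it is not built. -/
theorem IsBLCP.indepFun_of_notMem (hN : N.IsBLCP P) {T : Set (RadarSource c)} {i : RadarSource c}
    (hi : i ∉ T) {α β : Type*} [MeasurableSpace α] [MeasurableSpace β] {X : S → α} {Z : S → β}
    (hX : Measurable[N.sigmaOf T] X) (hZ : Measurable[N.sigma i] Z) : IndepFun X Z P := by
  have h := indep_iSup_of_disjoint hN.sigma_le hN.indep (S := T) (T := {i})
    (Set.disjoint_singleton_right.2 hi)
  rw [iSup_singleton] at h
  exact indep_of_indep_of_le_right (indep_of_indep_of_le_left h hX.comap_le) hZ.comap_le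

variable [IsProbabilityMeasure P]

/-- Integrating out the fading of one vehicle. -/
theorem IsBLCP.integral_mul_exp_fading (hN : N.IsBLCP P) {T : Set (RadarSource c)} {j : c.Street}
    {k : ℕ} (hT : RadarSource.fading j k ∉ T) {V C : S → ℝ} (hV : Measurable[N.sigmaOf T] V)
    (hC : Measurable[N.sigmaOf T] C) (hV1 : ∀ ω, |V ω| ≤ 1) (hC0 : ∀ ω, 0 ≤ C ω) :
    ∫ ω, V ω * Real.exp (-(C ω * |N.fading j k ω|)) ∂P = ∫ ω, V ω * (1 / (1 + C ω)) ∂P := by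
  have hV' := hV.mono (hN.sigmaOf_le T) le_rfl
  have hC' := hC.mono (hN.sigmaOf_le T) le_rfl
  have hΦ : Measurable fun x : (ℝ × ℝ) × ℝ => x.1.1 * Real.exp (-(x.1.2 * |x.2|)) := by
    have : Measurable fun x : (ℝ × ℝ) × ℝ => |x.2| := measurable_abs.comp measurable_snd
    fun_prop
  have hind := hN.indepFun_of_notMem hT (hV.prodMk hC) (comap_measurable (N.fading j k))
  have hint : Integrable (fun ω => V ω * Real.exp (-(C ω * |N.fading j k ω|))) P := by
    refine Integrable.of_bound
      (hΦ.comp ((hV'.prodMk hC').prodMk (hN.measurable_fading j k))).aestronglyMeasurable 1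
      (Eventually.of_forall fun ω => ?_)
    rw [norm_mul, Real.norm_eq_abs, Real.norm_of_nonneg (Real.exp_nonneg _)]
    have h0 : 0 ≤ C ω * |N.fading j k ω| := mul_nonneg (hC0 ω) (abs_nonneg _)
    exact mul_le_one₀ (hV1 ω) (Real.exp_nonneg _) (Real.exp_le_one_iff.2 (by linarith))
  have := integral_comp_prod_of_indepFun (hV'.prodMk hC') (hN.measurable_fading j k) hind
    hΦ.stronglyMeasurable hint
  rw [this]
  congr 1 with ω
  rw [(hN.fading_law j k).map_eq, integral_const_mul]
  have hpos : ∀ᵐ z ∂(expMeasure 1), 0 ≤ z := by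
    have := expMeasure_Iic_zero one_pos
    rw [ae_iff]
    exact measure_mono_null (fun z hz => (not_le.1 hz).le) this
  rw [integral_congr_ae (g := fun z => Real.exp (-(C ω * z)))
    (hpos.mono fun z hz => by simp only [abs_of_nonneg hz]),
    integral_exp_neg_mul_expMeasure one_pos (hC0 ω)]

/-- Integrating out the transmission indicator of one vehicle. -/
theorem IsBLCP.integral_mul_transmits (hN : N.IsBLCP P) {T : Set (RadarSource c)} {j : c.Street}
    {k : ℕ} (hT : RadarSource.transmits j k ∉ T) {V C : S → ℝ} (hV : Measurable[N.sigmaOf T] V)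
    (hC : Measurable[N.sigmaOf T] C) (hV1 : ∀ ω, |V ω| ≤ 1) (hC0 : ∀ ω, 0 ≤ C ω) :
    ∫ ω, V ω * (1 / (1 + C ω * (if N.transmits j k ω then 1 else 0))) ∂P =
      ∫ ω, V ω * (c.p * (1 / (1 + C ω)) + (1 - c.p)) ∂P := by
  have hV' := hV.mono (hN.sigmaOf_le T) le_rfl
  have hC' := hC.mono (hN.sigmaOf_le T) le_rfl
  have hΦ : Measurable fun x : (ℝ × ℝ) × Bool =>
      x.1.1 * (1 / (1 + x.1.2 * (if x.2 then 1 else 0))) := by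
    have : Measurable fun x : (ℝ × ℝ) × Bool => if x.2 then (1 : ℝ) else 0 :=
      (measurable_of_countable fun τ : Bool => if τ then (1 : ℝ) else 0).comp measurable_snd
    fun_prop
  have hind := hN.indepFun_of_notMem hT (hV.prodMk hC) (comap_measurable (N.transmits j k))
  have hint : Integrable
      (fun ω => V ω * (1 / (1 + C ω * (if N.transmits j k ω then 1 else 0)))) P := by
    refine Integrable.of_bound
      (hΦ.comp ((hV'.prodMk hC').prodMk (hN.measurable_transmits j k))).aestronglyMeasurable 1
      (Eventually.of_forall fun ω => ?_)
    have h0 : 0 ≤ C ω * (if N.transmits j k ω then 1 else 0) :=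
      mul_nonneg (hC0 ω) (by split_ifs <;> norm_num)
    rw [norm_mul, Real.norm_eq_abs, Real.norm_of_nonneg (by positivity)]
    exact mul_le_one₀ (hV1 ω) (by positivity) ((div_le_one (by linarith)).2 (by linarith))
  have := integral_comp_prod_of_indepFun (hV'.prodMk hC') (hN.measurable_transmits j k) hind
    hΦ.stronglyMeasurable hint
  rw [this]
  congr 1 with ω
  rw [integral_map_bool (hN.measurable_transmits j k) (hN.transmits_law j k)]
  simp
  ring

/-- Integrating out the fading and the transmission indicators of finitely many vehicles. -/
theorem IsBLCP.integral_mul_prod_exp_load (hc : c.Valid) (hN : N.IsBLCP P)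
    (F : Finset (c.Street × ℕ)) : ∀ {V : S → ℝ}, Measurable[N.sigmaOf (geometrySources c)] V →
    (∀ ω, |V ω| ≤ 1) → ∫ ω, V ω * ∏ a ∈ F, Real.exp (-N.load a ω) ∂P =
      ∫ ω, V ω * ∏ a ∈ F, c.vehicleFactor (N.place a.1 a.2 ω) ∂P := by
  induction F using Finset.cons_induction with
  | empty => simp
  | cons a F ha ih =>
    intro V hV hV1
    set T : Set (RadarSource c) := geometrySources c ∪
      ((fun a : c.Street × ℕ => RadarSource.fading a.1 a.2) '' F ∪
        (fun a : c.Street × ℕ => RadarSource.transmits a.1 a.2) '' F) with hT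
    have hgT : geometrySources c ⊆ T := Set.subset_union_left
    have hfT : RadarSource.fading a.1 a.2 ∉ T := by
      rintro (h | ⟨b, hb, h⟩ | ⟨b, hb, h⟩)
      · exact fading_notMem_geometrySources _ _ h
      · simp only [RadarSource.fading.injEq] at h
        exact ha (Prod.ext h.1 h.2 ▸ hb)
      · cases h
    have htT : RadarSource.transmits a.1 a.2 ∉ T := by
      rintro (h | ⟨b, hb, h⟩ | ⟨b, hb, h⟩)
      · exact transmits_notMem_geometrySources _ _ h
      · cases h
      · simp only [RadarSource.transmits.injEq] at h
        exact ha (Prod.ext h.1 h.2 ▸ hb)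
    have hfT' : RadarSource.fading a.1 a.2 ∉ insert (RadarSource.transmits a.1 a.2) T := by
      rintro (h | h)
      · cases h
      · exact hfT h
    set W : S → ℝ := fun ω => V ω * ∏ a ∈ F, Real.exp (-N.load a ω) with hW
    have hWm : Measurable[N.sigmaOf T] W := by
      refine (hV.mono (sigmaOf_mono hgT) le_rfl).mul ?_
      refine @Finset.measurable_fun_prod _ _ _ _ _ _ (N.sigmaOf T) _ _ fun b hb => ?_
      exact Real.measurable_exp.comp (measurable_load hc hgT
        (Or.inr (Or.inl ⟨b, hb, rfl⟩)) (Or.inr (Or.inr ⟨b, hb, rfl⟩))).neg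
    have hW1 : ∀ ω, |W ω| ≤ 1 := fun ω => by
      have h0 : 0 ≤ ∏ a ∈ F, Real.exp (-N.load a ω) :=
        Finset.prod_nonneg fun b _ => Real.exp_nonneg _
      rw [hW, abs_mul, abs_of_nonneg h0]
      refine mul_le_one₀ (hV1 ω) h0
        (Finset.prod_le_one (fun b _ => Real.exp_nonneg _) fun b _ => ?_)
      exact Real.exp_le_one_iff.2 (by linarith [load_nonneg (N := N) hc b ω])
    set C : S → ℝ := fun ω => c.vehicleLoad (N.place a.1 a.2 ω) with hC
    have hCm : Measurable[N.sigmaOf (geometrySources c)] C :=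
      (RadarParams.measurable_vehicleLoad hc).comp (measurable_place_of_geometry subset_rfl a.1 a.2)
    have hCT := hCm.mono (sigmaOf_mono hgT) le_rfl
    have hC0 : ∀ ω, 0 ≤ C ω := fun ω => RadarParams.vehicleLoad_nonneg hc _
    have hTi : T ⊆ insert (RadarSource.transmits a.1 a.2) T := Set.subset_insert _ _
    have h1 := hN.integral_mul_exp_fading hfT' (hWm.mono (sigmaOf_mono hTi) le_rfl)
      (C := fun ω => C ω * (if N.transmits a.1 a.2 ω then 1 else 0))
      ((hCT.mono (sigmaOf_mono hTi) le_rfl).mul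
        (measurable_indicator_transmits (Set.mem_insert _ _))) hW1
      fun ω => mul_nonneg (hC0 ω) (by split_ifs <;> norm_num)
    have h2 := hN.integral_mul_transmits htT hWm hCT hW1 hC0
    have hV'm : Measurable[N.sigmaOf (geometrySources c)]
        fun ω => V ω * c.vehicleFactor (N.place a.1 a.2 ω) :=
      hV.mul ((RadarParams.measurable_vehicleFactor hc).comp
        (measurable_place_of_geometry subset_rfl a.1 a.2))
    have h3 := ih hV'm fun ω => by
      have := (RadarParams.vehicleFactor_pos hc (N.place a.1 a.2 ω)).le
      rw [abs_mul, abs_of_nonneg this]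
      exact mul_le_one₀ (hV1 ω) this (RadarParams.vehicleFactor_le_one hc _)
    calc ∫ ω, V ω * ∏ a ∈ Finset.cons a F ha, Real.exp (-N.load a ω) ∂P
        = ∫ ω, W ω * Real.exp (-(C ω * (if N.transmits a.1 a.2 ω then 1 else 0) *
            |N.fading a.1 a.2 ω|)) ∂P := by
          congr 1 with ω
          rw [Finset.prod_cons, hW]
          simp only [load, hC]
          ring
      _ = ∫ ω, W ω * (c.p * (1 / (1 + C ω)) + (1 - c.p)) ∂P := h1.trans h2
      _ = ∫ ω, V ω * c.vehicleFactor (N.place a.1 a.2 ω) *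
            ∏ a ∈ F, Real.exp (-N.load a ω) ∂P := by
          congr 1 with ω
          rw [RadarParams.vehicleFactor_eq, hW]
          ring
      _ = _ := by
          rw [h3]
          congr 1 with ω
          rw [Finset.prod_cons]
          ring

end RadarNetwork

/-! ### The signal fraction and the total interference -/

namespace RadarNetwork

variable {c : RadarParams} {S : Type*} {N : RadarNetwork c S}

variable (N) in
/-- The total normalised interference power. -/
def totalLoad (ω : S) : ℝ := ∑ j : c.Street, ∑' k : ℕ, N.load (j, k) ω

theorem totalLoad_nonneg (hc : c.Valid) (ω : S) : 0 ≤ N.totalLoad ω :=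
  Finset.sum_nonneg fun j _ => tsum_nonneg fun k => load_nonneg hc (j, k) ω

/-- The sources of randomness other than the radar cross-section of the target. -/
def nonTargetSources (c : RadarParams) : Set (RadarSource c) := {RadarSource.rcs}ᶜ

theorem geometrySources_subset : geometrySources c ⊆ nonTargetSources c := by
  intro i hi h
  rw [Set.mem_singleton_iff.1 h] at hi
  exact rcs_notMem_geometrySources hi

theorem measurable_totalLoad (hc : c.Valid) :
    Measurable[N.sigmaOf (nonTargetSources c)] N.totalLoad := by
  refine @Finset.measurable_fun_sum _ _ _ _ _ _ (N.sigmaOf (nonTargetSources c)) _ _ fun j _ => ?_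
  refine @Measurable.tsum _ _ _ (N.sigmaOf (nonTargetSources c)) _ _ _ _ _ _ _ _ _ _ _ _ fun k => ?_
  exact measurable_load hc geometrySources_subset
    (show RadarSource.fading j k ∈ ({RadarSource.rcs} : Set (RadarSource c))ᶜ by simp)
    (show RadarSource.transmits j k ∈ ({RadarSource.rcs} : Set (RadarSource c))ᶜ by simp)

theorem tendsto_sum_load {ω : S} (hω : ∀ j, {k | N.place j k ω ∈ c.interferingRegion}.Finite) :
    Tendsto (fun n : ℕ => ∑ j : c.Street, ∑ k ∈ Finset.range n, N.load (j, k) ω) atTop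
      (𝓝 (N.totalLoad ω)) := by
  refine tendsto_finsetSum _ fun j _ => ?_
  refine (summable_of_ne_finset_zero (s := (hω j).toFinset) fun k hk => ?_).hasSum.tendsto_sum_nat
  have : N.place j k ω ∉ c.interferingRegion := by simpa using hk
  simp [load, RadarParams.vehicleLoad, this]

theorem streetFactor_nonneg (hc : c.Valid) (j : c.Street) (ω : S) : 0 ≤ N.streetFactor j ω :=
  ge_of_tendsto' (tendsto_streetFactor hc j ω) fun _ =>
    Finset.prod_nonneg fun _ _ => (RadarParams.vehicleFactor_pos hc _).le

theorem streetFactor_le_one (hc : c.Valid) (j : c.Street) (ω : S) : N.streetFactor j ω ≤ 1 :=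
  le_of_tendsto' (tendsto_streetFactor hc j ω) fun _ =>
    Finset.prod_le_one (fun _ _ => (RadarParams.vehicleFactor_pos hc _).le)
      fun _ _ => RadarParams.vehicleFactor_le_one hc _

variable [MeasurableSpace S] {P : Measure S}

theorem IsBLCP.ae_finite_interfering (hc : c.Valid) (hN : N.IsBLCP P) :
    ∀ᵐ ω ∂P, ∀ j, {k | N.place j k ω ∈ c.interferingRegion}.Finite := by
  rw [ae_all_iff]
  intro j
  have := (hN.pos_poisson j).ae_finite (A := Set.Icc (-(c.RB + |c.r0|)) (c.RB + |c.r0|))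
    measurableSet_Icc (by simp)
  filter_upwards [this] with ω hω
  refine hω.subset fun k hk => ?_
  have h1 := RadarParams.abs_sub_le_RB hc (show N.place j k ω ∈ c.interferingRegion from hk)
  have h2 : |c.r0 * Real.cos (N.place j k ω).1.1| ≤ |c.r0| := by
    rw [abs_mul]
    exact mul_le_of_le_one_right (abs_nonneg _) (Real.abs_cos_le_one _)
  have h3 : N.pos j k ω = (N.place j k ω).2 := rfl
  simp only [Set.mem_Icc, Set.mem_ofPred_eq]
  rw [← abs_le, h3]
  have := abs_add_le ((N.place j k ω).2 - c.r0 * Real.cos (N.place j k ω).1.1)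
    (c.r0 * Real.cos (N.place j k ω).1.1)
  rw [sub_add_cancel] at this
  linarith

theorem IsBLCP.ae_fading_nonneg (hN : N.IsBLCP P) : ∀ᵐ ω ∂P, ∀ j k, 0 ≤ N.fading j k ω := by
  simp_rw [ae_all_iff]
  intro j k
  have : ∀ᵐ z ∂(P.map (N.fading j k)), 0 ≤ z := by
    rw [(hN.fading_law j k).map_eq, ae_iff]
    exact measure_mono_null (fun z hz => (not_le.1 hz).le) (expMeasure_Iic_zero one_pos)
  exact ae_of_ae_map (hN.measurable_fading j k).aemeasurable this

theorem IsBLCP.ae_rcs_pos (hc : c.Valid) (hN : N.IsBLCP P) : ∀ᵐ ω ∂P, 0 < N.rcs ω := by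
  have : ∀ᵐ z ∂(P.map N.rcs), 0 < z := by
    rw [hN.rcs_law.map_eq, ae_iff]
    exact measure_mono_null (fun z hz => not_lt.1 hz) (expMeasure_Iic_zero (inv_pos.2 hc.σbar_pos))
  exact ae_of_ae_map hN.measurable_rcs.aemeasurable this

/-- The signal fraction exceeds the threshold if and only if the radar cross-section exceeds a
multiple of the total normalised interference. -/
theorem IsBLCP.ae_lt_SF_iff (hc : c.Valid) (hN : N.IsBLCP P) :
    ∀ᵐ ω ∂P, c.βSF < N.SF ω ↔ c.σbar * N.totalLoad ω < N.rcs ω := by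
  filter_upwards [hN.ae_fading_nonneg, hN.ae_rcs_pos hc] with ω hf hr
  have hσ := hc.σbar_pos
  have hγ := hc.γ_pos
  have hP := hc.power_pos
  have hR := Real.rpow_pos_of_pos hc.R_pos (-2 * c.α)
  have hβ := hc.βSF_nonneg
  have hβ1 : 0 < 1 - c.βSF := by linarith [hc.βSF_lt_one]
  set G := c.γ * c.power * c.R ^ (-2 * c.α) with hG
  have hG0 : 0 < G := by positivity
  have hsig : N.signal ω = G * N.rcs ω := by rw [signal, hG]; ring
  have hI0 : 0 ≤ N.interference ω := by
    refine Finset.sum_nonneg fun j _ => tsum_nonneg fun k => ?_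
    split_ifs
    · have := hf j k
      positivity
    · exact le_rfl
  have hload : c.σbar * N.totalLoad ω = c.βSF / (G * (1 - c.βSF)) * N.interference ω := by
    rw [totalLoad, interference, Finset.mul_sum, Finset.mul_sum]
    refine Finset.sum_congr rfl fun j _ => ?_
    rw [← tsum_mul_left, ← tsum_mul_left]
    congr 1 with k
    have hv : ‖N.vehicle j k ω - c.ego‖ =
        c.egoDist (N.street j ω).1 (N.street j ω).2 (N.pos j k ω) :=
      c.norm_streetPoint_sub_ego _ _ _
    have hmem : N.place j k ω ∈ c.interferingRegion ↔
        c.Interferes (N.street j ω).1 (N.vehicle j k ω) := Iff.rfl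
    have hl : N.load (j, k) ω = c.vehicleLoad (N.place j k ω) *
        (if N.transmits j k ω then 1 else 0) * N.fading j k ω := by
      rw [load, abs_of_nonneg (hf j k)]
    rw [hl, hv]
    by_cases h1 : c.Interferes (N.street j ω).1 (N.vehicle j k ω)
    · rw [RadarParams.vehicleLoad, if_pos (hmem.2 h1)]
      by_cases h2 : N.transmits j k ω = true
      · simp only [h1, h2, if_true, and_self, place, RadarParams.β', hG]
        field_simp
      · simp [h2]
    · rw [RadarParams.vehicleLoad, if_neg fun h => h1 (hmem.1 h)]
      simp [h1]
  rw [hload, SF, hsig, lt_div_iff₀ (by positivity), div_mul_eq_mul_div,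
    div_lt_iff₀ (by positivity)]
  constructor <;> intro h <;> nlinarith

variable [IsProbabilityMeasure P]

/-- Integrating out the radar cross-section of the target. -/
theorem IsBLCP.integral_indicator_rcs (hc : c.Valid) (hN : N.IsBLCP P) {V : S → ℝ}
    (hV : Measurable[N.sigmaOf (geometrySources c)] V) (hV1 : ∀ ω, |V ω| ≤ 1) :
    ∫ ω, V ω * (if c.σbar * N.totalLoad ω < N.rcs ω then 1 else 0) ∂P =
      ∫ ω, V ω * Real.exp (-N.totalLoad ω) ∂P := by
  have hσ := hc.σbar_pos
  have hLm := measurable_totalLoad (N := N) hc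
  have hVm := hV.mono (sigmaOf_mono geometrySources_subset) le_rfl
  have hV' := hVm.mono (hN.sigmaOf_le _) le_rfl
  have hL' := hLm.mono (hN.sigmaOf_le _) le_rfl
  have hi : RadarSource.rcs ∉ nonTargetSources c := fun h => h rfl
  have hΦ : Measurable fun x : (ℝ × ℝ) × ℝ =>
      x.1.1 * (if c.σbar * x.1.2 < x.2 then 1 else 0) := by
    refine (measurable_fst.comp measurable_fst).mul (Measurable.ite ?_ measurable_const
      measurable_const)
    exact measurableSet_lt (by fun_prop) (by fun_prop)
  have hind := hN.indepFun_of_notMem hi (hVm.prodMk hLm) (comap_measurable N.rcs)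
  have hint : Integrable
      (fun ω => V ω * (if c.σbar * N.totalLoad ω < N.rcs ω then 1 else 0)) P := by
    refine Integrable.of_bound
      (hΦ.comp ((hV'.prodMk hL').prodMk hN.measurable_rcs)).aestronglyMeasurable 1
      (Eventually.of_forall fun ω => ?_)
    rw [norm_mul]
    refine mul_le_one₀ (hV1 ω) (norm_nonneg _) ?_
    split_ifs <;> simp
  have := integral_comp_prod_of_indepFun (hV'.prodMk hL') hN.measurable_rcs hind
    hΦ.stronglyMeasurable hint
  rw [this]
  congr 1 with ω
  rw [hN.rcs_law.map_eq, integral_const_mul]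
  have h0 : 0 ≤ c.σbar * N.totalLoad ω := mul_nonneg hσ.le (totalLoad_nonneg hc ω)
  have h1 : (fun z : ℝ => if c.σbar * N.totalLoad ω < z then (1 : ℝ) else 0) =
      (Set.Ioi (c.σbar * N.totalLoad ω)).indicator 1 := by
    ext z; simp [Set.indicator_apply]
  rw [h1, integral_indicator_one measurableSet_Ioi, expMeasure_real_Ioi (inv_pos.2 hσ) h0,
    inv_mul_cancel_left₀ hσ.ne']

/-- Integrating out the fading and the transmission indicators of all vehicles: both sides are
limits of integrals over the first `n` vehicles on each street. -/
theorem IsBLCP.integral_mul_exp_totalLoad (hc : c.Valid) (hN : N.IsBLCP P) {V : S → ℝ}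
    (hV : Measurable[N.sigmaOf (geometrySources c)] V) (hV1 : ∀ ω, |V ω| ≤ 1) :
    ∫ ω, V ω * Real.exp (-N.totalLoad ω) ∂P = ∫ ω, V ω * ∏ j, N.streetFactor j ω ∂P := by
  have hV' := hV.mono (hN.sigmaOf_le _) le_rfl
  have hstep : ∀ n : ℕ,
      ∫ ω, V ω * Real.exp (-∑ j : c.Street, ∑ k ∈ Finset.range n, N.load (j, k) ω) ∂P =
        ∫ ω, V ω * ∏ j : c.Street, ∏ k ∈ Finset.range n, c.vehicleFactor (N.place j k ω) ∂P :=
    fun n => by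
      have := hN.integral_mul_prod_exp_load hc (Finset.univ ×ˢ Finset.range n) hV hV1
      simp_rw [Finset.prod_product] at this
      rw [← this]
      congr 1 with ω
      rw [← Finset.sum_neg_distrib, Real.exp_sum]
      congr 2 with j
      rw [← Finset.sum_neg_distrib, Real.exp_sum]
  have hloadm : ∀ a, Measurable (N.load a) := fun a =>
    (measurable_load hc (T := Set.univ) (Set.subset_univ _) trivial trivial).mono
      (hN.sigmaOf_le _) le_rfl
  have hpl : ∀ j k, Measurable fun ω => c.vehicleFactor (N.place j k ω) := fun j k =>
    (RadarParams.measurable_vehicleFactor hc).comp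
      ((measurable_place_of_geometry subset_rfl j k).mono (hN.sigmaOf_le _) le_rfl)
  have h1 : Tendsto (fun n : ℕ =>
      ∫ ω, V ω * Real.exp (-∑ j : c.Street, ∑ k ∈ Finset.range n, N.load (j, k) ω) ∂P) atTop
      (𝓝 (∫ ω, V ω * Real.exp (-N.totalLoad ω) ∂P)) := by
    refine tendsto_integral_of_dominated_convergence (fun _ => 1) (fun n => ?_)
      (integrable_const _) (fun n => Eventually.of_forall fun ω => ?_) ?_
    · exact (hV'.mul (Real.measurable_exp.comp (Finset.measurable_fun_sum _ fun j _ =>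
        Finset.measurable_fun_sum _ fun k _ => hloadm (j, k)).neg)).aestronglyMeasurable
    · rw [norm_mul, Real.norm_of_nonneg (Real.exp_nonneg _)]
      refine mul_le_one₀ (hV1 ω) (Real.exp_nonneg _) (Real.exp_le_one_iff.2 ?_)
      exact neg_nonpos.2 (Finset.sum_nonneg fun j _ => Finset.sum_nonneg fun k _ =>
        load_nonneg hc _ _)
    · filter_upwards [hN.ae_finite_interfering hc] with ω hω
      exact ((Real.continuous_exp.tendsto _).comp (tendsto_sum_load hω).neg).const_mul _
  have h2 : Tendsto (fun n : ℕ =>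
      ∫ ω, V ω * ∏ j : c.Street, ∏ k ∈ Finset.range n, c.vehicleFactor (N.place j k ω) ∂P) atTop
      (𝓝 (∫ ω, V ω * ∏ j, N.streetFactor j ω ∂P)) := by
    have hf0 : ∀ x, 0 ≤ c.vehicleFactor x := fun x => (RadarParams.vehicleFactor_pos hc x).le
    refine tendsto_integral_of_dominated_convergence (fun _ => 1) (fun n => ?_)
      (integrable_const _) (fun n => Eventually.of_forall fun ω => ?_)
      (Eventually.of_forall fun ω => ?_)
    · exact (hV'.mul (Finset.measurable_fun_prod _ fun j _ =>
        Finset.measurable_fun_prod _ fun k _ => hpl j k)).aestronglyMeasurable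
    · have h0 : 0 ≤ ∏ j : c.Street, ∏ k ∈ Finset.range n, c.vehicleFactor (N.place j k ω) :=
        Finset.prod_nonneg fun j _ => Finset.prod_nonneg fun k _ => hf0 _
      rw [norm_mul, Real.norm_of_nonneg h0]
      exact mul_le_one₀ (hV1 ω) h0 (Finset.prod_le_one
        (fun j _ => Finset.prod_nonneg fun k _ => hf0 _)
        fun j _ => Finset.prod_le_one (fun k _ => hf0 _)
          fun k _ => RadarParams.vehicleFactor_le_one hc _)
    · exact (tendsto_finsetProd _ fun j _ => tendsto_streetFactor hc j ω).const_mul _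
  simp_rw [hstep] at h1
  exact tendsto_nhds_unique h1 h2

/-- The conditional success probability is the product of the factors of all vehicles. -/
theorem IsBLCP.pSF_ae_eq (hc : c.Valid) (hN : N.IsBLCP P) :
    N.pSF P =ᵐ[P] fun ω => ∏ j, N.streetFactor j ω := by
  have hle : N.geometry ≤ (inferInstance : MeasurableSpace S) := by
    rw [geometry_eq_sigmaOf]; exact hN.sigmaOf_le _
  have hprodm : Measurable[N.geometry] fun ω => ∏ j, N.streetFactor j ω := by
    rw [geometry_eq_sigmaOf]
    exact @Finset.measurable_fun_prod _ _ _ _ _ _ (N.sigmaOf (geometrySources c)) _ _ fun j _ =>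
      measurable_streetFactor hc (fun i _ => line_mem_geometrySources i) (pos_mem_geometrySources j)
  have hprodint : Integrable (fun ω => ∏ j, N.streetFactor j ω) P := by
    refine Integrable.of_bound (hprodm.mono hle le_rfl).aestronglyMeasurable 1
      (Eventually.of_forall fun ω => ?_)
    rw [Real.norm_of_nonneg (Finset.prod_nonneg fun j _ => streetFactor_nonneg hc j ω)]
    exact Finset.prod_le_one (fun j _ => streetFactor_nonneg hc j ω)
      fun j _ => streetFactor_le_one hc j ω
  set f : S → ℝ := fun ω => if c.σbar * N.totalLoad ω < N.rcs ω then 1 else 0 with hf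
  have hfm : Measurable f := by
    refine Measurable.ite (measurableSet_lt ?_ hN.measurable_rcs) measurable_const measurable_const
    exact ((measurable_totalLoad (N := N) hc).mono (hN.sigmaOf_le _) le_rfl).const_mul _
  have hfint : Integrable f P := by
    refine Integrable.of_bound hfm.aestronglyMeasurable 1 (Eventually.of_forall fun ω => ?_)
    simp only [hf]
    split_ifs <;> simp
  have hcongr : ({ω | c.βSF < N.SF ω}.indicator fun _ => (1 : ℝ)) =ᵐ[P] f := by
    filter_upwards [hN.ae_lt_SF_iff hc] with ω hω
    simp only [hf, Set.indicator_apply, Set.mem_ofPred_eq, hω]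
  refine (condExp_congr_ae hcongr).trans (ae_eq_condExp_of_forall_setIntegral_eq hle hfint
    (fun s _ _ => hprodint.integrableOn) (fun s hs _ => ?_)
    hprodm.stronglyMeasurable.aestronglyMeasurable).symm
  have hs' : MeasurableSet s := hle s hs
  have hV : Measurable[N.sigmaOf (geometrySources c)] (s.indicator fun _ => (1 : ℝ)) := by
    rw [← geometry_eq_sigmaOf]
    exact (@measurable_const _ _ _ N.geometry _).indicator hs
  have hV1 : ∀ ω, |s.indicator (fun _ => (1 : ℝ)) ω| ≤ 1 := fun ω => by
    by_cases h : ω ∈ s <;> simp [h]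
  have hmul : ∀ g : S → ℝ, ∫ ω in s, g ω ∂P = ∫ ω, s.indicator (fun _ => (1 : ℝ)) ω * g ω ∂P :=
    fun g => by
      rw [← integral_indicator hs']
      congr 1 with ω
      by_cases h : ω ∈ s <;> simp [h]
  rw [hmul, hmul, hN.integral_indicator_rcs hc hV hV1, hN.integral_mul_exp_totalLoad hc hV hV1]

end RadarNetwork

/-! ### Moments of the conditional success probability -/

theorem ofReal_finsetProd_cpow {ι : Type*} (s : Finset ι) {f : ι → ℝ} (hf : ∀ i, 0 ≤ f i) (b : ℂ) :
    ((∏ i ∈ s, f i : ℝ) : ℂ) ^ b = ∏ i ∈ s, (f i : ℂ) ^ b := by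
  induction s using Finset.cons_induction with
  | empty => simp
  | cons a s ha ih =>
    rw [Finset.prod_cons, Finset.prod_cons, Complex.ofReal_mul,
      Complex.mul_cpow_ofReal_nonneg (hf a) (Finset.prod_nonneg fun i _ => hf i), ih]

namespace RadarParams

variable {c : RadarParams}

theorem positionsFactor_eq_prod (hc : c.Valid) {x : (ℝ × ℝ) × (ℕ → ℝ)}
    (hx : {k | (x.1, x.2 k) ∈ c.interferingRegion}.Finite) :
    c.positionsFactor x = ∏ k ∈ hx.toFinset, c.vehicleFactor (x.1, x.2 k) := by
  have hone : ∀ k ∉ hx.toFinset, c.vehicleFactor (x.1, x.2 k) = 1 := fun k hk => by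
    have : (x.1, x.2 k) ∉ c.interferingRegion := by simpa using hk
    simp [vehicleFactor, this]
  refine le_antisymm ?_ (le_ciInf fun n => ?_)
  · obtain ⟨n, hn⟩ := hx.toFinset.exists_nat_subset_range
    refine (ciInf_le ⟨0, ?_⟩ n).trans_eq
      (Finset.prod_subset hn fun k _ hk => hone k hk).symm
    rintro _ ⟨n, rfl⟩
    exact Finset.prod_nonneg fun k _ => (vehicleFactor_pos hc _).le
  · rw [← Finset.prod_sdiff (Finset.inter_subset_right (s₁ := Finset.range n) (s₂ := hx.toFinset))]
    have h1 : ∏ k ∈ Finset.range n, c.vehicleFactor (x.1, x.2 k) =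
        ∏ k ∈ Finset.range n ∩ hx.toFinset, c.vehicleFactor (x.1, x.2 k) :=
      (Finset.prod_subset Finset.inter_subset_left fun k hk hk' => hone k fun h =>
        hk' (Finset.mem_inter.2 ⟨hk, h⟩)).symm
    rw [h1]
    exact mul_le_of_le_one_left (Finset.prod_nonneg fun k _ => (vehicleFactor_pos hc _).le)
      (Finset.prod_le_one (fun k _ => (vehicleFactor_pos hc _).le)
        fun k _ => vehicleFactor_le_one hc _)

theorem ae_finite_interferingRegion (hc : c.Valid) {S : Type*} [MeasurableSpace S] {P : Measure S}
    {X : ℕ → S → ℝ} (hX : IsPoissonProcess P c.lam X) (l : ℝ × ℝ) :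
    ∀ᵐ ω ∂P, {k | (l, X k ω) ∈ c.interferingRegion}.Finite := by
  have := hX.ae_finite (A := Set.Icc (c.r0 * Real.cos l.1 - c.RB) (c.r0 * Real.cos l.1 + c.RB))
    measurableSet_Icc (by simp)
  filter_upwards [this] with ω hω
  refine hω.subset fun k hk => ?_
  have := abs_le.1 (abs_sub_le_RB hc (show (l, X k ω) ∈ c.interferingRegion from hk))
  exact ⟨by linarith, by linarith⟩

/-- The moment of the product of the factors of a Poisson process of vehicles on a given street,
from the probability generating functional. -/
theorem integral_positionsFactor_cpow (hc : c.Valid) {S : Type*} [MeasurableSpace S]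
    {P : Measure S} {X : ℕ → S → ℝ} (hX : IsPoissonProcess P c.lam X) {b : ℂ}
    (hb : c.p < 1 ∨ -1 < c.α * b.re) (l : ℝ × ℝ) :
    Integrable (fun ω => (c.positionsFactor (l, fun k => X k ω) : ℂ) ^ b) P ∧
      ∫ ω, (c.positionsFactor (l, fun k => X k ω) : ℂ) ^ b ∂P = c.streetMoment b l := by
  obtain ⟨K, hK⟩ := integrable_powerDeviation hc hb
  have hsupp : Function.support (fun t => c.powerDeviation b (l, t)) ⊆
      Set.Icc (c.r0 * Real.cos l.1 - c.RB) (c.r0 * Real.cos l.1 + c.RB) := fun t ht => by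
    have hmem : (l, t) ∈ c.interferingRegion := by
      by_contra h
      exact ht (powerDeviation_of_notMem b h)
    have := abs_le.1 (abs_sub_le_RB hc hmem)
    exact ⟨by linarith, by linarith⟩
  have key := hX.integral_finprod_one_add hc.lam_pos.le
    ((measurable_powerDeviation hc b).comp measurable_prodMk_left) measurableSet_Icc
    (by simp) hsupp (hK l).1
  have hae : (fun ω => ∏ᶠ k, (1 + c.powerDeviation b (l, X k ω))) =ᵐ[P]
      fun ω => (c.positionsFactor (l, fun k => X k ω) : ℂ) ^ b := by
    filter_upwards [ae_finite_interferingRegion hc hX l] with ω hω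
    rw [positionsFactor_eq_prod (x := (l, fun k => X k ω)) hc hω,
      ofReal_finsetProd_cpow _ fun k => (vehicleFactor_pos hc _).le]
    rw [finprod_eq_prod_of_mulSupport_subset (s := hω.toFinset)]
    · simp [powerDeviation]
    · intro k hk
      by_contra h
      have : (l, X k ω) ∉ c.interferingRegion := by simpa using h
      exact hk (by simp [powerDeviation_of_notMem b this])
  exact ⟨key.1.congr hae, (integral_congr_ae hae).symm.trans key.2⟩

/-- The absolute moment is the moment of order `re b`, which gives integrability over the
streets. -/
theorem integral_norm_positionsFactor_cpow (hc : c.Valid) {S : Type*} [MeasurableSpace S]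
    {P : Measure S} {X : ℕ → S → ℝ} (hX : IsPoissonProcess P c.lam X) {b : ℂ}
    (hb : c.p < 1 ∨ -1 < c.α * b.re) (l : ℝ × ℝ) :
    ((∫ ω, ‖(c.positionsFactor (l, fun k => X k ω) : ℂ) ^ b‖ ∂P : ℝ) : ℂ) =
      c.streetMoment (b.re : ℂ) l := by
  rw [← (integral_positionsFactor_cpow hc hX (b := (b.re : ℂ)) (by simpa using hb) l).2,
    ← integral_complex_ofReal]
  refine integral_congr_ae ?_
  filter_upwards [ae_finite_interferingRegion hc hX l] with ω hω
  have hpos : 0 < c.positionsFactor (l, fun k => X k ω) := by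
    rw [positionsFactor_eq_prod (x := (l, fun k => X k ω)) hc hω]
    exact Finset.prod_pos fun k _ => vehicleFactor_pos hc _
  rw [Complex.norm_cpow_eq_rpow_re_of_pos hpos, Complex.ofReal_cpow hpos.le]

/-- The moment for a street with random parameters independent of the vehicle positions. -/
theorem integral_positionsFactor_cpow_of_indepFun (hc : c.Valid) {S : Type*} [MeasurableSpace S]
    {P : Measure S} [IsProbabilityMeasure P] {X : ℕ → S → ℝ} (hX : IsPoissonProcess P c.lam X)
    {Y : S → ℝ × ℝ} (hY : Measurable Y) (hYX : IndepFun Y (fun ω k => X k ω) P) {b : ℂ}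
    (hb : c.p < 1 ∨ -1 < c.α * b.re) :
    Integrable (fun ω => (c.positionsFactor (Y ω, fun k => X k ω) : ℂ) ^ b) P ∧
      ∫ ω, (c.positionsFactor (Y ω, fun k => X k ω) : ℂ) ^ b ∂P =
        ∫ l, c.streetMoment b l ∂(P.map Y) := by
  have hXm : Measurable fun ω k => X k ω := measurable_pi_lambda _ hX.measurable
  have hm : Measurable fun x => (c.positionsFactor x : ℂ) ^ b :=
    (Complex.measurable_ofReal.comp (measurable_positionsFactor hc)).pow_const b
  have hml : ∀ l, Measurable fun x : ℕ → ℝ => (c.positionsFactor (l, x) : ℂ) ^ b :=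
    fun l => hm.comp measurable_prodMk_left
  have := Measure.isProbabilityMeasure_map (μ := P) hY.aemeasurable
  have := Measure.isProbabilityMeasure_map (μ := P) hXm.aemeasurable
  obtain ⟨K, hK⟩ := exists_norm_streetMoment_le hc (b := (b.re : ℂ)) (by simpa using hb)
  have hint : Integrable (fun ω => (c.positionsFactor (Y ω, fun k => X k ω) : ℂ) ^ b) P := by
    have hprod : Integrable (fun x => (c.positionsFactor x : ℂ) ^ b)
        ((P.map Y).prod (P.map fun ω k => X k ω)) := by
      rw [integrable_prod_iff hm.aestronglyMeasurable]
      refine ⟨Eventually.of_forall fun l => ?_, ?_⟩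
      · exact (integrable_map_measure (hml l).aestronglyMeasurable hXm.aemeasurable).2
          (integral_positionsFactor_cpow hc hX hb l).1
      · refine Integrable.of_bound
          (StronglyMeasurable.integral_prod_right' hm.norm.stronglyMeasurable).aestronglyMeasurable
          K (Eventually.of_forall fun l => ?_)
        rw [integral_map hXm.aemeasurable (hml l).norm.aestronglyMeasurable,
          ← Complex.norm_real, integral_norm_positionsFactor_cpow hc hX hb l]
        exact hK l
    rw [← (indepFun_iff_map_prod_eq_prod_map_map hY.aemeasurable hXm.aemeasurable).1 hYX] at hprod
    exact hprod.comp_measurable (hY.prodMk hXm)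
  refine ⟨hint, ?_⟩
  rw [integral_comp_prod_of_indepFun hY hXm hYX hm.stronglyMeasurable hint,
    integral_map hY.aemeasurable (measurable_streetMoment hc b).aestronglyMeasurable]
  congr 1 with ω
  rw [integral_map hXm.aemeasurable (hml _).aestronglyMeasurable,
    (integral_positionsFactor_cpow hc hX hb (Y ω)).2]

end RadarParams

namespace RadarNetwork

variable {c : RadarParams} {S : Type*} {N : RadarNetwork c S}

/-- The sources of randomness that determine a street and the positions of its vehicles. -/
def streetSources (j : c.Street) : Set (RadarSource c) :=
  {i | i = RadarSource.pos j ∨ ∃ k, j = some k ∧ i = RadarSource.line k}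

theorem pairwise_disjoint_streetSources :
    Pairwise (Function.onFun Disjoint (streetSources (c := c))) := by
  intro j j' hjj
  rw [Function.onFun, Set.disjoint_left]
  rintro i (rfl | ⟨k, rfl, rfl⟩) (h | ⟨k', rfl, h⟩)
  · exact hjj (by simpa using h)
  · cases h
  · cases h
  · exact hjj (by simpa using h)

variable [MeasurableSpace S] {P : Measure S}

theorem IsBLCP.iIndepFun_streetFactor_cpow (hc : c.Valid) (hN : N.IsBLCP P) (b : ℂ) :
    iIndepFun (fun (j : c.Street) ω => (N.streetFactor j ω : ℂ) ^ b) P := by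
  rw [iIndepFun_iff_iIndep]
  refine iIndep_of_iIndep_of_le (iIndep_biSup_of_pairwise_disjoint hN.sigma_le hN.indep
    (pairwise_disjoint_streetSources (c := c))) fun j => ?_
  have h1 : Measurable[N.sigmaOf (streetSources j)] (N.streetFactor j) :=
    measurable_streetFactor hc (fun i hi => Or.inr ⟨i, hi, rfl⟩) (Or.inl rfl)
  exact ((Complex.measurable_ofReal.comp h1).pow_const b).comap_le

theorem IsBLCP.integral_streetFactor_none (hc : c.Valid) (hN : N.IsBLCP P) {b : ℂ}
    (hb : c.p < 1 ∨ -1 < c.α * b.re) :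
    Integrable (fun ω => (N.streetFactor none ω : ℂ) ^ b) P ∧
      ∫ ω, (N.streetFactor none ω : ℂ) ^ b ∂P = c.streetMoment b (0, 0) :=
  RadarParams.integral_positionsFactor_cpow hc (hN.pos_poisson none) hb (0, 0)

variable [IsProbabilityMeasure P]

theorem IsBLCP.integral_streetFactor_some (hc : c.Valid) (hN : N.IsBLCP P) {b : ℂ}
    (hb : c.p < 1 ∨ -1 < c.α * b.re) (i : Fin (c.nB - 1)) :
    Integrable (fun ω => (N.streetFactor (some i) ω : ℂ) ^ b) P ∧
      ∫ ω, (N.streetFactor (some i) ω : ℂ) ^ b ∂P =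
        ∫ l, c.streetMoment b l ∂(ProbabilityTheory.cond volume c.streetDomain) := by
  rw [← (hN.line_law i).map_eq]
  refine RadarParams.integral_positionsFactor_cpow_of_indepFun hc (hN.pos_poisson (some i))
    (hN.measurable_line i) ?_ hb
  have hi : RadarSource.pos (some i) ∉ ({RadarSource.line i} : Set (RadarSource c)) := by simp
  exact hN.indepFun_of_notMem hi
    ((comap_measurable (N.line i)).mono (sigma_le_sigmaOf
      (N := N) (i := RadarSource.line i) (Set.mem_singleton _)) le_rfl)
    (comap_measurable fun ω k => N.pos (some i) k ω)

end RadarNetwork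

end

theorem mainTheorem4 (c : RadarParams) (hc : c.Valid) {S : Type*} [MeasurableSpace S]
    (P : Measure S) [IsProbabilityMeasure P] (N : RadarNetwork c S) (hN : N.IsBLCP P)
    (b : ℂ) (hb : c.p < 1 ∨ -1 < c.α * b.re) :
    Integrable (fun ω => (N.pSF P ω : ℂ) ^ b) P ∧
    ∫ ω, (N.pSF P ω : ℂ) ^ b ∂P =
      Complex.exp (-(c.lam : ℂ) * ∫ v in (0 : ℝ)..c.RB,
        (1 - ((c.p / (1 + c.β' * v ^ (-c.α)) + 1 - c.p : ℝ) : ℂ) ^ b)) *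
      ((1 / (2 * (π : ℂ) * (c.Rg : ℂ))) *
        ∫ r in (0 : ℝ)..c.Rg, ∫ θ in (0 : ℝ)..(2 * π),
          Complex.exp (-(c.lam : ℂ) * ∫ v in (c.aB θ r)..(c.bB θ r),
            (1 - ((c.p / (1 + c.β' * (c.wB θ r v) ^ (-c.α)) + 1 - c.p : ℝ) : ℂ) ^ b)))
        ^ (c.nB - 1) := by
  have hae : (fun ω => ∏ j, (N.streetFactor j ω : ℂ) ^ b) =ᵐ[P]
      fun ω => (N.pSF P ω : ℂ) ^ b := by
    filter_upwards [hN.pSF_ae_eq hc] with ω hω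
    rw [hω, ofReal_finsetProd_cpow _ fun j => RadarNetwork.streetFactor_nonneg hc j ω]
  have hind := hN.iIndepFun_streetFactor_cpow hc b
  have hm : ∀ j, Measurable fun ω => (N.streetFactor j ω : ℂ) ^ b := fun j =>
    (Complex.measurable_ofReal.comp ((RadarNetwork.measurable_streetFactor hc
      (T := Set.univ) (fun _ _ => trivial) trivial).mono (hN.sigmaOf_le _) le_rfl)).pow_const b
  have hint : ∀ j, Integrable (fun ω => (N.streetFactor j ω : ℂ) ^ b) P
    | none => (hN.integral_streetFactor_none hc hb).1
    | some i => (hN.integral_streetFactor_some hc hb i).1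
  refine ⟨(iIndepFun_integrable_prod hind hm hint).congr hae, ?_⟩
  rw [← integral_congr_ae hae,
    hind.integral_fun_prod_eq_prod_integral fun j => (hm j).aestronglyMeasurable,
    Fintype.prod_option, (hN.integral_streetFactor_none hc hb).2]
  simp_rw [(hN.integral_streetFactor_some hc hb _).2]
  rw [Finset.prod_const, Finset.card_univ, Fintype.card_fin,
    RadarParams.integral_streetMoment hc hb, RadarParams.streetMoment,
    RadarParams.integral_powerDeviation_ego hc, mul_neg, neg_mul]
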